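/- **Conventions.** Let $G=(V,E(G))$ be a simple graph and let $l\ge 4$. The line graph $L(G)$ has the edges of $G$ as vertices, two distinct edges being adjacent iff they share an end vertex. The square $H^2$ of a graph $H$ has the same vertices as $H$, and $x,y$ are adjacent in $H^2$ iff $1\le \operatorname{dist}_H(x,y)\le 2$. A *sprout* of size $n$ is a graph $S=(V(S),U\cup W\cup E)$ whose edge set is split into pairwise disjoint sets $U=\{u_1,\dots,u_n\}$, $W=\{w_1,\dots,w_q\}$ and $E$, with $|U|=n$, $|W|=q$ and $\lceil n/2\rceil\le q\le n$, such that (indices of $u$ modulo $n$, of $w$ modulo $q$): 1. There is a cycle $C$ in $S$ containing the edges of $W$ in the order $w_1,\dots,w_q$. 2. $U$ is sorted by the order of appearance of its elements along $C$ (an edge that is not in $C$ appears when $C$ reaches one of its end vertices), with $u_1\cap w_q\ne\emptyset$ and $u_2\cap w_1\ne\emptyset$; moreover $u_i\cap u_j=\emptyset$ whenever $j\ne i$ and $j\neq i\pm1 \pmod n$. 3. If $w_{i+1}$ directly follows $w_i$ on $C$, then exactly one $u\in U$ contains their common vertex, and this $u$ meets no edge of $W$ other than $w_i$ and $w_{i+1}$.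 Such edges $u$ are called *pending*. 4. If $w_{i+1}$ does not directly follow $w_i$ on $C$, then either there is one $u\in U$ such that the path $w_i\,u\,w_{i+1}$ is part of $C$, or there are exactly two edges $t,u\in U$ such that the path $w_i\,t\,u\,w_{i+1}$ is part of $C$. 5. The pending edges are pairwise nonadjacent, and all edges of $U$ that are not pending are edges of $C$. A sprout is *fertile* (or *unwithered*) if no edge $e\in E$ meets both $u_i$ and $u_j$ for some $i\neq j$ with $j\ne i\pm1\pmod n$. The graph $G$ *contains* a sprout $S$ if $S$ is an induced subgraph of $G$. **Lemma.** For every simple graph $G$ and every $l\ge 4$, the graph $L(G)^2$ contains an induced cycle of length $l$ if and only if $G$ contains a fertile sprout of size $l$. -/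

import Mathlib

namespace LineGraphSquare

variable {V : Type*}

/-- The `k`-th power of a graph: two vertices are adjacent iff `1 ≤ dist(x, y) ≤ k`.
The extended distance is used, so that vertices of different components have distance `⊤`. -/
def power (G : SimpleGraph V) (k : ℕ) : SimpleGraph V where
  Adj x y := 1 ≤ G.edist x y ∧ G.edist x y ≤ (k : ℕ∞)
  symm := ⟨fun x y h => by rwa [SimpleGraph.edist_comm] at h⟩
  loopless := ⟨fun x h => by simp at h⟩

/-- `e ∩ f ≠ ∅` for edges `e`, `f`. -/
def Meets (e f : Sym2 V) : Prop := ∃ x, x ∈ e ∧ x ∈ f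

/-- `j = i + 1 (mod n)`. -/
def Next {n : ℕ} (i j : Fin n) : Prop := (j : ℕ) = ((i : ℕ) + 1) % n

/-- `j ≠ i` and `j ≠ i ± 1 (mod n)`. -/
def NonConsecutive {n : ℕ} (i j : Fin n) : Prop := i ≠ j ∧ ¬ Next i j ∧ ¬ Next j i

/-- The edges listed in `l` occur on the closed walk `C` one directly after the other, in this
order (going around the closed walk past its base point if necessary). -/
def IsPartOf {G : SimpleGraph V} {c : V} (l : List (Sym2 V)) (C : G.Walk c c) : Prop :=
  ∃ k : ℕ, l <+: C.edges.rotate k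

open Classical in
/-- The moment at which an edge is met when `C` is traversed from its base point: at time `2k` the
traversal is at the vertex number `k` of `C`, at time `2k + 1` on the edge number `k` of `C`
(counting from `0`). An edge of `C` is met when it is traversed, any other edge when the first of
its end vertices is reached. -/
noncomputable def appearance {G : SimpleGraph V} {c : V} (C : G.Walk c c) (e : Sym2 V) : ℕ :=
  if e ∈ C.edges then 2 * C.edges.idxOf e + 1 else 2 * C.support.findIdx (fun x => x ∈ e)

/-- A sprout structure of size `n` on the graph `S = (V, U ∪ W ∪ E)` (a subgraph of some ambient
graph `G`). The edges `u_1, …, u_n` and `w_1, …, w_q` are indexed by `0, …, n - 1` and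
`0, …, q - 1`; `E` consists of the remaining edges of `S`. The cycle `C` is given with a base point
and a direction. -/
structure Sprout {G : SimpleGraph V} (S : G.Subgraph) (n : ℕ) where
  /-- the number of `w`-edges -/
  q : ℕ
  /-- `⌈n / 2⌉ ≤ q` -/
  le_q : (n + 1) / 2 ≤ q
  q_le : q ≤ n
  /-- the `u`-edges -/
  u : Fin n → Sym2 V
  /-- the `w`-edges -/
  w : Fin q → Sym2 V
  u_mem : ∀ i, u i ∈ S.edgeSet
  w_mem : ∀ i, w i ∈ S.edgeSet
  u_injective : Function.Injective u
  w_injective : Function.Injective w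
  u_ne_w : ∀ i j, u i ≠ w j
  /-- base point of the cycle -/
  base : V
  /-- the cycle -/
  C : G.Walk base base
  isCycle : C.IsCycle
  C_mem : ∀ e ∈ C.edges, e ∈ S.edgeSet
  /-- (i) `C` contains the edges of `W` in the order `w_1, …, w_q`. -/
  w_order : (List.ofFn w).Sublist C.edges
  /-- (ii) `U` is sorted by the order of appearance along `C`. -/
  u_order : StrictMono fun i => appearance C (u i)
  /-- (ii) `u_1 ∩ w_q ≠ ∅` -/
  u_one : ∀ (i : Fin n) (j : Fin q), (i : ℕ) = 0 → (j : ℕ) + 1 = q → Meets (u i) (w j)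
  /-- (ii) `u_2 ∩ w_1 ≠ ∅` -/
  u_two : ∀ (i : Fin n) (j : Fin q), (i : ℕ) = 1 → (j : ℕ) = 0 → Meets (u i) (w j)
  /-- (ii) non-consecutive `u`-edges are disjoint. -/
  u_disjoint : ∀ i j, NonConsecutive i j → ¬ Meets (u i) (u j)
  /-- (iii) If `w_{i+1}` directly follows `w_i` on `C`, then exactly one `u`-edge contains their
  common vertex -/
  existsUnique_pending : ∀ i i', Next i i' → IsPartOf [w i, w i'] C →
    ∃! j, ∃ x, x ∈ w i ∧ x ∈ w i' ∧ x ∈ u j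
  /-- (iii) and this `u`-edge, a pending edge, meets no other `w`-edges. -/
  pending_meets : ∀ i i', Next i i' → IsPartOf [w i, w i'] C →
    ∀ j, (∃ x, x ∈ w i ∧ x ∈ w i' ∧ x ∈ u j) → ∀ m, Meets (u j) (w m) → m = i ∨ m = i'
  /-- (iv) Otherwise `w_i` and `w_{i+1}` are joined along `C` by one or by two `u`-edges. -/
  joined : ∀ i i', Next i i' → ¬ IsPartOf [w i, w i'] C →
    (∃ j, IsPartOf [w i, u j, w i'] C) ∨ (∃ j k, IsPartOf [w i, u j, u k, w i'] C)
  /-- (v) Any two pending edges are nonadjacent. -/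
  pending_disjoint : ∀ j k, j ≠ k →
    (∃ i i', Next i i' ∧ IsPartOf [w i, w i'] C ∧ ∃ x, x ∈ w i ∧ x ∈ w i' ∧ x ∈ u j) →
    (∃ i i', Next i i' ∧ IsPartOf [w i, w i'] C ∧ ∃ x, x ∈ w i ∧ x ∈ w i' ∧ x ∈ u k) →
    ¬ Meets (u j) (u k)
  /-- (v) All `u`-edges that are not pending are edges of `C`. -/
  mem_of_not_pending : ∀ j,
    (¬ ∃ i i', Next i i' ∧ IsPartOf [w i, w i'] C ∧ ∃ x, x ∈ w i ∧ x ∈ w i' ∧ x ∈ u j) →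
    u j ∈ C.edges

/-- The class `E` of the edges of the sprout that are neither `u`- nor `w`-edges. -/
def Sprout.E {G : SimpleGraph V} {S : G.Subgraph} {n : ℕ} (P : Sprout S n) : Set (Sym2 V) :=
  S.edgeSet \ (Set.range P.u ∪ Set.range P.w)

/-- A sprout is fertile if no edge of `E` connects two non-consecutive `u`-edges. -/
def Sprout.IsFertile {G : SimpleGraph V} {S : G.Subgraph} {n : ℕ} (P : Sprout S n) : Prop :=
  ∀ e ∈ P.E, ∀ i j, NonConsecutive i j → ¬ (Meets e (P.u i) ∧ Meets e (P.u j))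

/-- `G` contains, as an induced subgraph, a fertile (unwithered) sprout of size `n`. -/
def ContainsFertileSprout (G : SimpleGraph V) (n : ℕ) : Prop :=
  ∃ S : G.Subgraph, S.IsInduced ∧ ∃ P : Sprout S n, P.IsFertile

end LineGraphSquare

/-!
Two distinct edges are adjacent in `L(G)²` iff some edge of `G`, possibly one of the two, meets
both (`Near`). So an induced cycle of length `n` in `L(G)²` is a cyclic sequence of `n` edges in
which exactly the consecutive ones are near each other (`cycleGraph_isIndContained_iff`).

From a sprout to an induced cycle. The conditions on the gaps between consecutive `w`-edges,
followed once around the cycle `C`, show that every edge of `C` is a `w`-edge or a `u`-edge and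
that no three consecutive ones are `u`-edges (`Sprout.edge_cases`). Every `u`-edge has a site on
`C`: its own position, or the vertex at which it is pending. A pending edge has no second vertex on
`C` (`Sprout.IsPendingAt.eq_of_vert_mem`), so the order of appearance is the order of the sites,
and two `u`-edges without a further site between them have consecutive indices. Consecutive
`u`-edges then meet or are joined by the `w`-edge between their sites (`Sprout.near_of_next`).
Conversely, a `w`-edge meets only the `u`-edges at the neighbouring sites, a `u`-edge meets at most
one other `u`-edge, and fertility excludes the remaining edges
(`Sprout.not_near_of_nonConsecutive`).

From an induced cycle to a sprout. Let `u i` be the edges of the induced cycle, with `i`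
in `ZMod n`. As `u i` and `u (i + 2)` are not near each other, of two consecutive pairs at most one meets,
and the numbering can be chosen such that the last edge does not meet the first. Join `u i`
to `u (i + 1)` at their common vertex if they meet, and by an edge of `G`, a link, otherwise; the links
become the `w`-edges. Let `a i` and `b i` be the vertices at which `u i` is entered and left. The
closed sequence `a 0, b 0, a 1, b 1, …` stands still from `a i` to `b i` if `u i` is pending, and
from `b i` to `a (i + 1)` if `u i` meets `u (i + 1)`. Since an edge of `G` that meets two
consecutive edges of the ring meets no third one (`EdgeRing.eq_or_eq_of_meets`), it never returns
to a vertex it has left (`LinkedRing.seq_succ_injOn`), so its proper steps form a cycle. All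
positions on this cycle are numbers of proper steps before a given time, and rotating the cycle
amounts to shifting the window of time, from which the conditions on consecutive `w`-edges are read
off. The whole graph `G` serves as the induced subgraph.
-/

namespace LineGraphSquare

variable {V : Type*}

/-! ### Adjacency in the square of a line graph -/

/-- Two edges are near each other if some edge of `G`, possibly one of the two, meets both. For
distinct edges this is adjacency in the square of the line graph. -/
def Near (G : SimpleGraph V) (e f : Sym2 V) : Prop := ∃ g ∈ G.edgeSet, Meets e g ∧ Meets g f

theorem Meets.symm {e f : Sym2 V} (h : Meets e f) : Meets f e :=
  h.imp fun _ hx => hx.symm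

theorem meets_self (e : Sym2 V) : Meets e e := by
  induction e with | _ x y => exact ⟨x, by simp, by simp⟩

theorem Near.symm {G : SimpleGraph V} {e f : Sym2 V} (h : Near G e f) : Near G f e := by
  obtain ⟨g, hg, h1, h2⟩ := h
  exact ⟨g, hg, h2.symm, h1.symm⟩

theorem Meets.near {G : SimpleGraph V} {e f : Sym2 V} (he : e ∈ G.edgeSet) (h : Meets e f) :
    Near G e f := ⟨e, he, meets_self e, h⟩

theorem lineGraph_adj_iff_meets {G : SimpleGraph V} {e f : G.edgeSet} :
    G.lineGraph.Adj e f ↔ e ≠ f ∧ Meets (e : Sym2 V) f := by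
  simp [SimpleGraph.lineGraph, Meets, Set.Nonempty]

theorem power_two_adj_iff {W : Type*} {H : SimpleGraph W} {x y : W} :
    (power H 2).Adj x y ↔ x ≠ y ∧ (H.Adj x y ∨ ∃ z, H.Adj x z ∧ H.Adj z y) := by
  constructor
  · rintro ⟨h1, h2⟩
    have hne : x ≠ y := by rintro rfl; simp at h1
    refine ⟨hne, ?_⟩
    have h3 : H.edist x y ≠ ⊤ := fun h => by rw [h] at h2; exact absurd h2 (by decide)
    obtain ⟨p, hp⟩ := SimpleGraph.exists_walk_of_edist_ne_top h3
    rw [← hp] at h2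
    have h4 : p.length ≤ 2 := by exact_mod_cast h2
    match p, h4 with
    | .nil, _ => exact absurd rfl hne
    | .cons h .nil, _ => exact Or.inl h
    | .cons h (.cons h' .nil), _ => exact Or.inr ⟨_, h, h'⟩
    | .cons _ (.cons _ (.cons _ _)), h4 => simp at h4
  · rintro ⟨hne, h⟩
    refine ⟨Order.one_le_iff_pos.mpr (SimpleGraph.edist_pos_of_ne hne), ?_⟩
    rcases h with h | ⟨z, h, h'⟩
    · exact (SimpleGraph.Walk.cons h .nil).edist_le.trans (by simp)
    · exact (SimpleGraph.Walk.cons h (.cons h' .nil)).edist_le.trans (by simp)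

theorem power_two_lineGraph_adj_iff {G : SimpleGraph V} {e f : G.edgeSet} :
    (power G.lineGraph 2).Adj e f ↔ e ≠ f ∧ Near G e f := by
  rw [power_two_adj_iff]
  refine and_congr_right fun hne => ⟨?_, ?_⟩
  · rintro (h | ⟨g, h1, h2⟩)
    · exact Meets.near e.2 (lineGraph_adj_iff_meets.mp h).2
    · exact ⟨g, g.2, (lineGraph_adj_iff_meets.mp h1).2, (lineGraph_adj_iff_meets.mp h2).2⟩
  · rintro ⟨g, hg, h1, h2⟩
    by_cases heg : (e : Sym2 V) = g
    · exact Or.inl (lineGraph_adj_iff_meets.mpr ⟨hne, heg ▸ h2⟩)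
    by_cases hfg : (f : Sym2 V) = g
    · exact Or.inl (lineGraph_adj_iff_meets.mpr ⟨hne, hfg ▸ h1⟩)
    · exact Or.inr ⟨⟨g, hg⟩, lineGraph_adj_iff_meets.mpr ⟨fun h => heg (by rw [h]), h1⟩,
        lineGraph_adj_iff_meets.mpr ⟨fun h => hfg (by rw [← h]), h2⟩⟩

theorem next_iff {n : ℕ} {i j : Fin n} :
    Next i j ↔ (j : ℕ) = i + 1 ∨ ((i : ℕ) + 1 = n ∧ (j : ℕ) = 0) := by
  unfold Next
  have hi := i.isLt
  have hj := j.isLt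
  rcases Nat.lt_or_ge ((i : ℕ) + 1) n with h | h
  · rw [Nat.mod_eq_of_lt h]; omega
  · have : (i : ℕ) + 1 = n := by omega
    rw [this, Nat.mod_self]; omega

theorem cycleGraph_adj_iff_next {n : ℕ} (hn : 4 ≤ n) {i j : Fin n} :
    (SimpleGraph.cycleGraph n).Adj i j ↔ Next i j ∨ Next j i := by
  rw [SimpleGraph.cycleGraph_adj', next_iff, next_iff, Fin.sub_def, Fin.sub_def]
  have hi := i.isLt
  have hj := j.isLt
  have key : ∀ a b : ℕ, a < n → b < n → ((n - b + a) % n = 1 ↔ a = b + 1 ∨ b + 1 = n ∧ a = 0) := by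
    intro a b ha hb
    rcases Nat.lt_or_ge (n - b + a) n with h | h
    · rw [Nat.mod_eq_of_lt h]; omega
    · rw [Nat.mod_eq_sub_mod h, Nat.mod_eq_of_lt (by omega)]; omega
  simp only
  rw [key _ _ hi hj, key _ _ hj hi, or_comm]

theorem next_irrefl {n : ℕ} (hn : 4 ≤ n) {i j : Fin n} (h : Next i j) : i ≠ j := by
  rintro rfl; rw [next_iff] at h; omega

/-- An induced cycle in the square of the line graph is a cyclic sequence of edges in which exactly
the consecutive ones are near each other. -/
theorem cycleGraph_isIndContained_iff (G : SimpleGraph V) {n : ℕ} (hn : 4 ≤ n) :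
    (SimpleGraph.cycleGraph n).IsIndContained (power G.lineGraph 2) ↔
      ∃ u : Fin n → Sym2 V, (∀ i, u i ∈ G.edgeSet) ∧ Function.Injective u ∧
        (∀ i j, Next i j → Near G (u i) (u j)) ∧
        (∀ i j, NonConsecutive i j → ¬ Near G (u i) (u j)) := by
  constructor
  · rintro ⟨φ⟩
    have hφ : ∀ i j, (power G.lineGraph 2).Adj (φ i) (φ j) ↔ Next i j ∨ Next j i := fun i j => by
      rw [φ.map_adj_iff, cycleGraph_adj_iff_next hn]
    refine ⟨fun i => φ i, fun i => (φ i).2, fun i j h => φ.injective (Subtype.ext h), ?_, ?_⟩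
    · intro i j h
      exact (power_two_lineGraph_adj_iff.mp ((hφ i j).mpr (Or.inl h))).2
    · intro i j h hnear
      have := (hφ i j).mp (power_two_lineGraph_adj_iff.mpr ⟨fun h' => h.1 (φ.injective h'), hnear⟩)
      exact this.elim h.2.1 h.2.2
  · rintro ⟨u, hu, hinj, hnext, hnon⟩
    refine ⟨⟨⟨fun i => ⟨u i, hu i⟩, fun i j h => hinj (congrArg Subtype.val h)⟩, ?_⟩⟩
    intro i j
    change (power G.lineGraph 2).Adj ⟨u i, hu i⟩ ⟨u j, hu j⟩ ↔ _
    rw [power_two_lineGraph_adj_iff, cycleGraph_adj_iff_next hn]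
    constructor
    · rintro ⟨hne, h⟩
      by_contra hc
      push Not at hc
      exact hnon i j ⟨fun h' => hne (by rw [h']), hc.1, hc.2⟩ h
    · rintro (h | h)
      · exact ⟨fun h' => next_irrefl hn h (hinj (congrArg Subtype.val h')), hnext _ _ h⟩
      · exact ⟨fun h' => next_irrefl hn h (hinj (congrArg Subtype.val h')).symm, (hnext _ _ h).symm⟩

/-! ### Cyclic indexing of the vertices and edges of a cycle -/

section Cycle

variable {G : SimpleGraph V} {c : V} {C : G.Walk c c}

/-- The vertices of a closed walk of length `N`, indexed cyclically by `ZMod N`. -/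
def cycVert (C : G.Walk c c) (p : ZMod C.length) : V := C.getVert p.val

/-- The edges of a closed walk of length `N`, indexed cyclically by `ZMod N`. -/
def cycEdge (C : G.Walk c c) (p : ZMod C.length) : Sym2 V := s(cycVert C p, cycVert C (p + 1))

theorem three_le_length_of_isCycle (hC : C.IsCycle) : 3 ≤ C.length :=
  hC.isCircuit.three_le_length

theorem neZero_length (hC : C.IsCycle) : NeZero C.length :=
  ⟨by have := three_le_length_of_isCycle hC; omega⟩

theorem zmod_one_ne_zero (hC : C.IsCycle) : (1 : ZMod C.length) ≠ 0 := by
  have h3 := three_le_length_of_isCycle hC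
  intro h
  have : ((1 : ℕ) : ZMod C.length) = 0 := by simpa using h
  rw [ZMod.natCast_eq_zero_iff] at this
  have := Nat.le_of_dvd one_pos this
  omega

theorem zmod_two_ne_zero (hC : C.IsCycle) : (2 : ZMod C.length) ≠ 0 := by
  have h3 := three_le_length_of_isCycle hC
  intro h
  have : ((2 : ℕ) : ZMod C.length) = 0 := by simpa using h
  rw [ZMod.natCast_eq_zero_iff] at this
  have := Nat.le_of_dvd two_pos this
  omega

theorem zmod_val_add_one {N : ℕ} (hN : 2 ≤ N) (p : ZMod N) :
    (p + 1).val = p.val + 1 ∨ (p.val + 1 = N ∧ (p + 1).val = 0) := by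
  have : NeZero N := ⟨by omega⟩
  have : Fact (1 < N) := ⟨by omega⟩
  have hp := p.val_lt
  rw [ZMod.val_add, ZMod.val_one]
  rcases Nat.lt_or_ge (p.val + 1) N with h | h
  · exact Or.inl (Nat.mod_eq_of_lt h)
  · have h' : p.val + 1 = N := by omega
    exact Or.inr ⟨h', by rw [h', Nat.mod_self]⟩

theorem cycVert_natCast (k : ℕ) (hk : k ≤ C.length) :
    cycVert C (k : ZMod C.length) = C.getVert k := by
  rcases hk.lt_or_eq with h | rfl
  · rw [cycVert, ZMod.val_natCast, Nat.mod_eq_of_lt h]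
  · rw [cycVert, ZMod.natCast_self, C.getVert_length]
    simp

theorem cycEdge_natCast (k : ℕ) (hk : k < C.edges.length) :
    cycEdge C (k : ZMod C.length) = C.edges[k] := by
  have hk' : k < C.length := by simpa using hk
  rw [cycEdge, SimpleGraph.Walk.getElem_edges, ← Nat.cast_succ, cycVert_natCast _ hk'.le,
    cycVert_natCast _ hk']

theorem mem_edges_iff_cycEdge (hC : C.IsCycle) {e : Sym2 V} :
    e ∈ C.edges ↔ ∃ p, cycEdge C p = e := by
  have := neZero_length hC
  rw [List.mem_iff_getElem]
  constructor
  · rintro ⟨k, hk, rfl⟩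
    exact ⟨k, cycEdge_natCast k hk⟩
  · rintro ⟨p, rfl⟩
    refine ⟨p.val, by simpa using p.val_lt, ?_⟩
    rw [← cycEdge_natCast, ZMod.natCast_zmod_val]

theorem cycVert_injective (hC : C.IsCycle) : Function.Injective (cycVert C) := by
  have := neZero_length hC
  intro p r h
  have hp := p.val_lt
  have hr := r.val_lt
  exact ZMod.val_injective _ (hC.getVert_injOn' (by simp; omega) (by simp; omega) h)

theorem cycVert_mem_cycEdge (hC : C.IsCycle) {p r : ZMod C.length} :
    cycVert C r ∈ cycEdge C p ↔ r = p ∨ r = p + 1 := by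
  rw [cycEdge, Sym2.mem_iff, (cycVert_injective hC).eq_iff, (cycVert_injective hC).eq_iff]

theorem exists_cycVert_of_mem {p : ZMod C.length} {x : V} (h : x ∈ cycEdge C p) :
    ∃ r, x = cycVert C r ∧ (r = p ∨ r = p + 1) := by
  rw [cycEdge, Sym2.mem_iff] at h
  rcases h with h | h
  · exact ⟨_, h, Or.inl rfl⟩
  · exact ⟨_, h, Or.inr rfl⟩

theorem cycEdge_injective (hC : C.IsCycle) : Function.Injective (cycEdge C) := by
  intro p r h
  have h1 := (cycVert_mem_cycEdge hC (p := r) (r := p)).mp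
    (h ▸ (cycVert_mem_cycEdge hC).mpr (Or.inl rfl))
  have h2 := (cycVert_mem_cycEdge hC (p := r) (r := p + 1)).mp
    (h ▸ (cycVert_mem_cycEdge hC).mpr (Or.inr rfl))
  rcases h1 with h1 | h1
  · exact h1
  · rcases h2 with h2 | h2
    · refine absurd ?_ (zmod_two_ne_zero hC)
      linear_combination h2 - h1
    · exact add_right_cancel h2

theorem cycEdge_meets (hC : C.IsCycle) {p r : ZMod C.length}
    (h : Meets (cycEdge C p) (cycEdge C r)) :
    r = p ∨ r = p + 1 ∨ p = r + 1 := by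
  obtain ⟨x, h1, h2⟩ := h
  obtain ⟨a, rfl, ha⟩ := exists_cycVert_of_mem h1
  obtain ⟨b, hb', hb⟩ := exists_cycVert_of_mem h2
  obtain rfl := cycVert_injective hC hb'
  rcases ha with rfl | rfl <;> rcases hb with hb | hb
  · exact Or.inl hb.symm
  · exact Or.inr (Or.inr hb)
  · exact Or.inr (Or.inl hb.symm)
  · exact Or.inl (add_right_cancel hb).symm

theorem IsPartOf.exists_cycEdge {l : List (Sym2 V)} (h : IsPartOf l C) :
    ∃ p : ZMod C.length, ∀ (t : ℕ) (ht : t < l.length), l[t] = cycEdge C (p + t) := by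
  obtain ⟨k, b, hb⟩ := h
  refine ⟨(k : ℕ), fun t ht => ?_⟩
  have hlen : t < (C.edges.rotate k).length := by rw [← hb]; simp; omega
  have h1 : l[t] = (C.edges.rotate k)[t] := by
    simp only [← hb]
    rw [List.getElem_append_left]
  rw [h1, List.getElem_rotate, ← cycEdge_natCast]
  congr 1
  rw [SimpleGraph.Walk.length_edges, ZMod.natCast_mod]
  push_cast
  ring

theorem appearance_cycEdge (hC : C.IsCycle) (p : ZMod C.length) :
    appearance C (cycEdge C p) = 2 * p.val + 1 := by
  classical
  have := neZero_length hC
  have hp : p.val < C.edges.length := by simpa using p.val_lt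
  have h : cycEdge C p = C.edges[p.val] := by rw [← cycEdge_natCast, ZMod.natCast_zmod_val]
  rw [appearance, if_pos ((mem_edges_iff_cycEdge hC).mpr ⟨p, rfl⟩), h,
    hC.isTrail.edges_nodup.idxOf_getElem]

theorem appearance_of_notMem (hC : C.IsCycle) {e : Sym2 V} (he : e ∉ C.edges) {p : ZMod C.length}
    (hp : cycVert C p ∈ e) (h : ∀ r, cycVert C r ∈ e → r = p) :
    appearance C e = 2 * p.val := by
  have := neZero_length hC
  have hlt := p.val_lt
  rw [appearance, if_neg he]
  congr 1
  have hlt' : p.val < C.support.length := by simp; omega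
  rw [List.findIdx_eq hlt']
  constructor
  · simpa [SimpleGraph.Walk.support_getElem_eq_getVert, cycVert] using hp
  · intro j hj
    simp only [decide_eq_false_iff_not, SimpleGraph.Walk.support_getElem_eq_getVert]
    intro hm
    rw [← cycVert_natCast _ (by omega)] at hm
    have := congrArg ZMod.val (h _ hm)
    rw [ZMod.val_natCast, Nat.mod_eq_of_lt (by omega)] at this
    omega

end Cycle

/-! ### The `u`-edges of a fertile sprout form an induced cycle -/

/-- In a cycle of length at least four there is no triangle. -/
theorem no_three_consecutive {n : ℕ} (hn : 4 ≤ n) {i j k : Fin n} (hij : i ≠ j) (hjk : j ≠ k)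
    (hik : i ≠ k) (h1 : ¬ NonConsecutive i j) (h2 : ¬ NonConsecutive j k)
    (h3 : ¬ NonConsecutive i k) : False := by
  simp only [NonConsecutive, next_iff, ne_eq, Fin.ext_iff] at *
  omega

theorem Next.unique {n : ℕ} {i j k : Fin n} (h1 : Next i j) (h2 : Next i k) : j = k :=
  Fin.ext (h1.trans h2.symm)

theorem exists_next {n : ℕ} (i : Fin n) : ∃ j, Next i j :=
  ⟨⟨(i + 1) % n, Nat.mod_lt _ (by have := i.isLt; omega)⟩, rfl⟩

/-- If `n` numbers in increasing order are placed on a cycle, then two of them with no further one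
in the cyclic interval between them have consecutive indices. -/
theorem next_of_strictMono {n : ℕ} {σ : Fin n → ℕ} (hσ : StrictMono σ) {i j : Fin n}
    (h : (σ i < σ j ∧ ∀ k, ¬ (σ i < σ k ∧ σ k < σ j)) ∨
      (σ j < σ i ∧ (∀ k, ¬ σ i < σ k) ∧ ∀ k, ¬ σ k < σ j)) : Next i j := by
  have hi := i.isLt
  have hj := j.isLt
  rw [next_iff]
  rcases h with ⟨h, hk⟩ | ⟨h, hk, hk'⟩
  · have hij : (i : ℕ) < j := hσ.lt_iff_lt.mp h
    by_contra hc
    refine hk ⟨i + 1, by omega⟩ ⟨hσ (Fin.lt_def.mpr (by simp)), hσ (Fin.lt_def.mpr ?_)⟩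
    simp only
    omega
  · right
    constructor
    · by_contra hc
      exact hk ⟨i + 1, by omega⟩ (hσ (Fin.lt_def.mpr (by simp)))
    · by_contra hc
      exact hk' ⟨0, by omega⟩ (hσ (Fin.lt_def.mpr (by simp only; omega)))

namespace Sprout

variable {G : SimpleGraph V} {S : G.Subgraph} {n : ℕ} (P : Sprout S n)

/-- The edge number `p` of the cycle of a sprout, counted cyclically from the base point. -/
abbrev edge (p : ZMod P.C.length) : Sym2 V := cycEdge P.C p

/-- The vertex number `p` of the cycle of a sprout; it lies on the edges `p - 1` and `p`. -/
abbrev vert (p : ZMod P.C.length) : V := cycVert P.C p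

theorem vert_mem_edge (p : ZMod P.C.length) : P.vert p ∈ P.edge p := by simp [cycEdge]

theorem vert_succ_mem_edge (p : ZMod P.C.length) : P.vert (p + 1) ∈ P.edge p := by simp [cycEdge]

theorem exists_edge_eq_w (m : Fin P.q) : ∃ p, P.edge p = P.w m :=
  (mem_edges_iff_cycEdge P.isCycle).mp (P.w_order.subset (by simp))

/-- What follows a `w`-edge on the cycle. -/
theorem after_w {p : ZMod P.C.length} {m : Fin P.q} (h : P.edge p = P.w m) :
    ∃ m', Next m m' ∧ ((IsPartOf [P.w m, P.w m'] P.C ∧ P.edge (p + 1) = P.w m') ∨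
      (∃ j, P.edge (p + 1) = P.u j ∧ P.edge (p + 2) = P.w m') ∨
      ∃ j k, P.edge (p + 1) = P.u j ∧ P.edge (p + 2) = P.u k ∧ P.edge (p + 3) = P.w m') := by
  obtain ⟨m', hm⟩ := exists_next m
  refine ⟨m', hm, ?_⟩
  by_cases hp : IsPartOf [P.w m, P.w m'] P.C
  · obtain ⟨r, hr⟩ := hp.exists_cycEdge
    obtain rfl : p = r := cycEdge_injective P.isCycle (h.trans (by simpa using hr 0 (by simp)))
    exact Or.inl ⟨hp, (by simpa using hr 1 (by simp) : _ = _).symm⟩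
  rcases P.joined m m' hm hp with ⟨j, hj⟩ | ⟨j, k, hj⟩
  · obtain ⟨r, hr⟩ := hj.exists_cycEdge
    obtain rfl : p = r := cycEdge_injective P.isCycle (h.trans (by simpa using hr 0 (by simp)))
    exact Or.inr (Or.inl ⟨j, (by simpa using hr 1 (by simp) : _ = _).symm,
      (by simpa using hr 2 (by simp) : _ = _).symm⟩)
  · obtain ⟨r, hr⟩ := hj.exists_cycEdge
    obtain rfl : p = r := cycEdge_injective P.isCycle (h.trans (by simpa using hr 0 (by simp)))
    exact Or.inr (Or.inr ⟨j, k, (by simpa using hr 1 (by simp) : _ = _).symm,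
      (by simpa using hr 2 (by simp) : _ = _).symm, (by simpa using hr 3 (by simp) : _ = _).symm⟩)

/-- Every edge of the cycle is a `w`-edge, or it is a `u`-edge followed by a `w`-edge, possibly
after one more `u`-edge. Starting from some `w`-edge, this propagates around the cycle. -/
theorem edge_cases (hn : 4 ≤ n) (p : ZMod P.C.length) :
    (∃ m, P.edge p = P.w m) ∨ (∃ j m, P.edge p = P.u j ∧ P.edge (p + 1) = P.w m) ∨
      ∃ j k m, P.edge p = P.u j ∧ P.edge (p + 1) = P.u k ∧ P.edge (p + 2) = P.w m := by
  have := neZero_length P.isCycle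
  obtain ⟨p₀, hp₀⟩ := P.exists_edge_eq_w ⟨0, by have := P.le_q; omega⟩
  have key : ∀ d : ℕ, (∃ m, P.edge (p₀ + d) = P.w m) ∨
      (∃ j m, P.edge (p₀ + d) = P.u j ∧ P.edge (p₀ + d + 1) = P.w m) ∨
      ∃ j k m, P.edge (p₀ + d) = P.u j ∧ P.edge (p₀ + d + 1) = P.u k ∧
        P.edge (p₀ + d + 2) = P.w m := by
    intro d
    induction d with
    | zero => exact Or.inl ⟨_, by simpa using hp₀⟩
    | succ d ih =>
      have e1 : p₀ + ((d + 1 : ℕ) : ZMod P.C.length) = p₀ + d + 1 := by push_cast; ring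
      have e2 : p₀ + (d : ZMod P.C.length) + 1 + 1 = p₀ + d + 2 := by ring
      have e3 : p₀ + (d : ZMod P.C.length) + 1 + 2 = p₀ + d + 3 := by ring
      rw [e1, e2, e3]
      rcases ih with ⟨m, h⟩ | ⟨j, m, h, h'⟩ | ⟨j, k, m, h, h', h''⟩
      · obtain ⟨m', -, ⟨-, h1⟩ | ⟨j, h1, h2⟩ | ⟨j, k, h1, h2, h3⟩⟩ := P.after_w h
        · exact Or.inl ⟨_, h1⟩
        · exact Or.inr (Or.inl ⟨_, _, h1, h2⟩)
        · exact Or.inr (Or.inr ⟨_, _, _, h1, h2, h3⟩)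
      · exact Or.inl ⟨_, h'⟩
      · exact Or.inr (Or.inl ⟨_, _, h', h''⟩)
  have := key (p - p₀).val
  rwa [ZMod.natCast_zmod_val, add_sub_cancel] at this

theorem edge_eq_w_or_u (hn : 4 ≤ n) (p : ZMod P.C.length) :
    (∃ m, P.edge p = P.w m) ∨ ∃ j, P.edge p = P.u j := by
  rcases P.edge_cases hn p with h | ⟨j, m, h, -⟩ | ⟨j, k, m, h, -⟩
  · exact Or.inl h
  · exact Or.inr ⟨j, h⟩
  · exact Or.inr ⟨j, h⟩

theorem not_three_u (hn : 4 ≤ n) {p : ZMod P.C.length} {i j k : Fin n} (h1 : P.edge p = P.u i)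
    (h2 : P.edge (p + 1) = P.u j) (h3 : P.edge (p + 2) = P.u k) : False := by
  rcases P.edge_cases hn p with ⟨m, h⟩ | ⟨_, m, -, h⟩ | ⟨_, _, m, -, -, h⟩
  · exact P.u_ne_w _ _ (h1.symm.trans h)
  · exact P.u_ne_w _ _ (h2.symm.trans h)
  · exact P.u_ne_w _ _ (h3.symm.trans h)

/-- The edge `u_j` is pending at the vertex number `s` of the cycle, between the `w`-edges number
`s - 1` and `s`. -/
def IsPendingAt (j : Fin n) (s : ZMod P.C.length) : Prop :=
  ∃ m m', Next m m' ∧ IsPartOf [P.w m, P.w m'] P.C ∧ P.edge (s - 1) = P.w m ∧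
    P.edge s = P.w m' ∧ P.vert s ∈ P.u j

theorem vert_eq_of_mem {p : ZMod P.C.length} {x : V} (h1 : x ∈ P.edge p)
    (h2 : x ∈ P.edge (p + 1)) : x = P.vert (p + 1) := by
  obtain ⟨a, rfl, ha⟩ := exists_cycVert_of_mem h1
  rw [cycVert_mem_cycEdge P.isCycle] at h2
  rcases ha with rfl | rfl
  · rcases h2 with h2 | h2
    · rw [← h2]
    · refine absurd ?_ (zmod_two_ne_zero P.isCycle)
      linear_combination -h2
  · rfl

theorem isPendingAt_of {p : ZMod P.C.length} {m m' : Fin P.q} {j : Fin n} (h1 : P.edge p = P.w m)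
    (h2 : P.edge (p + 1) = P.w m') (hm : Next m m') (hp : IsPartOf [P.w m, P.w m'] P.C) {x : V}
    (hx : x ∈ P.w m) (hx' : x ∈ P.w m') (hj : x ∈ P.u j) : P.IsPendingAt j (p + 1) := by
  obtain rfl : x = P.vert (p + 1) := P.vert_eq_of_mem (h1 ▸ hx) (h2 ▸ hx')
  exact ⟨m, m', hm, hp, by rw [add_sub_cancel_right, h1], h2, hj⟩

/-- Between two `w`-edges that follow each other directly there is a pending edge. -/
theorem exists_isPendingAt {p : ZMod P.C.length} {m m' : Fin P.q} (h1 : P.edge p = P.w m)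
    (h2 : P.edge (p + 1) = P.w m') : ∃ j, P.IsPendingAt j (p + 1) := by
  obtain ⟨k, hk, ⟨hp, h3⟩ | ⟨j, h3, -⟩ | ⟨j, k, h3, -⟩⟩ := P.after_w h1
  · obtain ⟨j, ⟨x, hx, hx', hj⟩, -⟩ := P.existsUnique_pending m k hk hp
    exact ⟨j, P.isPendingAt_of h1 h3 hk hp hx hx' hj⟩
  · exact absurd (h3.symm.trans h2) (P.u_ne_w _ _)
  · exact absurd (h3.symm.trans h2) (P.u_ne_w _ _)

variable {P}

theorem IsPendingAt.vert_mem {j : Fin n} {s : ZMod P.C.length} (h : P.IsPendingAt j s) :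
    P.vert s ∈ P.u j := by
  obtain ⟨m, m', -, -, -, -, h⟩ := h
  exact h

/-- The common vertex of the two `w`-edges next to a pending edge lies on all three edges. -/
theorem IsPendingAt.spec {j : Fin n} {s : ZMod P.C.length} (h : P.IsPendingAt j s) :
    ∃ m m', Next m m' ∧ IsPartOf [P.w m, P.w m'] P.C ∧ P.edge (s - 1) = P.w m ∧ P.edge s = P.w m' ∧
      P.vert s ∈ P.w m ∧ P.vert s ∈ P.w m' ∧ P.vert s ∈ P.u j := by
  obtain ⟨m, m', hm, hp, h1, h2, h3⟩ := h
  refine ⟨m, m', hm, hp, h1, h2, ?_, h2 ▸ P.vert_mem_edge s, h3⟩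
  have := P.vert_succ_mem_edge (s - 1)
  rwa [sub_add_cancel, h1] at this

theorem IsPendingAt.exists_pending {j : Fin n} {s : ZMod P.C.length} (h : P.IsPendingAt j s) :
    ∃ i i', Next i i' ∧ IsPartOf [P.w i, P.w i'] P.C ∧ ∃ x, x ∈ P.w i ∧ x ∈ P.w i' ∧ x ∈ P.u j := by
  obtain ⟨m, m', hm, hp, -, -, h1, h2, h3⟩ := h.spec
  exact ⟨m, m', hm, hp, _, h1, h2, h3⟩

theorem IsPendingAt.unique {j k : Fin n} {s : ZMod P.C.length} (hj : P.IsPendingAt j s)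
    (hk : P.IsPendingAt k s) : j = k := by
  obtain ⟨m, m', hm, hp, e1, e2, h1, h2, h3⟩ := hj.spec
  exact (P.existsUnique_pending m m' hm hp).unique ⟨_, h1, h2, h3⟩ ⟨_, h1, h2, hk.vert_mem⟩

theorem IsPendingAt.eq_of_meets {j : Fin n} {s r : ZMod P.C.length} (hj : P.IsPendingAt j s)
    {m : Fin P.q} (hr : P.edge r = P.w m) (h : Meets (P.u j) (P.w m)) : r = s ∨ r = s - 1 := by
  obtain ⟨a, b, hab, hp, e1, e2, h1, h2, h3⟩ := hj.spec
  rcases P.pending_meets a b hab hp j ⟨_, h1, h2, h3⟩ m h with rfl | rfl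
  · exact Or.inr (cycEdge_injective P.isCycle (hr.trans e1.symm))
  · exact Or.inl (cycEdge_injective P.isCycle (hr.trans e2.symm))

/-- A pending edge has only one vertex on the cycle. Its other end would lie on a `w`-edge that it
must not meet, or on two `u`-edges, which then form with it three pairwise meeting `u`-edges. -/
theorem IsPendingAt.eq_of_vert_mem (hn : 4 ≤ n) {j : Fin n} {s r : ZMod P.C.length}
    (hj : P.IsPendingAt j s) (hr : P.vert r ∈ P.u j) : r = s := by
  by_contra hne
  have hC := P.isCycle
  have hedge : ∀ t, P.vert r ∈ P.edge t → P.vert s ∈ P.edge t → P.u j = P.edge t := by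
    intro t h1 h2
    have hv : P.vert r ≠ P.vert s := fun h => hne (cycVert_injective hC h)
    exact ((Sym2.mem_and_mem_iff hv).mp ⟨hr, hj.vert_mem⟩).trans
      ((Sym2.mem_and_mem_iff hv).mp ⟨h1, h2⟩).symm
  obtain ⟨a, b, hab, hp, e1, e2, h1, h2, h3⟩ := hj.spec
  have m1 : P.vert r ∈ P.edge (r - 1) := by
    have := P.vert_succ_mem_edge (r - 1)
    rwa [sub_add_cancel] at this
  have m2 := P.vert_mem_edge r
  have n1 : P.u j ≠ P.edge (s - 1) := fun h => P.u_ne_w _ _ (h.trans e1)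
  have n2 : P.u j ≠ P.edge s := fun h => P.u_ne_w _ _ (h.trans e2)
  have hs1 : P.vert s ∈ P.edge (s - 1) := e1 ▸ h1
  have hs2 : P.vert s ∈ P.edge s := P.vert_mem_edge s
  rcases P.edge_eq_w_or_u hn r with ⟨m, hm⟩ | ⟨k, hk⟩
  · rcases hj.eq_of_meets hm ⟨_, hr, hm ▸ m2⟩ with h | h
    · exact hne h
    · exact n1 (hedge _ (h ▸ m2) hs1)
  rcases P.edge_eq_w_or_u hn (r - 1) with ⟨m, hm⟩ | ⟨k', hk'⟩
  · rcases hj.eq_of_meets hm ⟨_, hr, hm ▸ m1⟩ with h | h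
    · exact n2 (hedge _ (h ▸ m1) hs2)
    · exact hne (sub_left_injective h)
  have hr1 : r ≠ s - 1 := fun h => P.u_ne_w k a (by rw [← hk, h, e1])
  have hr2 : r - 1 ≠ s := fun h => P.u_ne_w k' b (by rw [← hk', h, e2])
  refine no_three_consecutive hn (i := j) (j := k) (k := k') ?_ ?_ ?_
    (fun h => P.u_disjoint _ _ h ⟨_, hr, hk ▸ m2⟩)
    (fun h => P.u_disjoint _ _ h ⟨_, hk ▸ m2, hk' ▸ m1⟩)
    (fun h => P.u_disjoint _ _ h ⟨_, hr, hk' ▸ m1⟩)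
  · rintro rfl
    have := hj.vert_mem
    rw [← hk, cycVert_mem_cycEdge hC] at this
    rcases this with h | h
    · exact hne h.symm
    · exact hr1 (by rw [h]; ring)
  · rintro rfl
    have := cycEdge_injective hC (hk.trans hk'.symm)
    exact zmod_one_ne_zero hC (by linear_combination this)
  · rintro rfl
    have := hj.vert_mem
    rw [← hk', cycVert_mem_cycEdge hC] at this
    rcases this with h | h
    · exact hr2 h.symm
    · exact hne (by rw [h]; ring)

theorem IsPendingAt.edge_ne (hn : 4 ≤ n) {j : Fin n} {s r : ZMod P.C.length}
    (hj : P.IsPendingAt j s) : P.edge r ≠ P.u j := by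
  intro h
  have h1 := hj.eq_of_vert_mem hn (h ▸ P.vert_mem_edge r)
  have h2 := hj.eq_of_vert_mem hn (h ▸ P.vert_succ_mem_edge r)
  exact zmod_one_ne_zero P.isCycle (by linear_combination h2 - h1)

variable (P)

/-- The place of the edge `u_j` on the cycle: it is the edge number `s`, or it is pending at the
vertex number `s`. -/
def IsSite (j : Fin n) (s : ZMod P.C.length) : Prop := P.edge s = P.u j ∨ P.IsPendingAt j s

theorem exists_isSite (j : Fin n) : ∃ s, P.IsSite j s := by
  by_cases h : ∃ i i', Next i i' ∧ IsPartOf [P.w i, P.w i'] P.C ∧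
      ∃ x, x ∈ P.w i ∧ x ∈ P.w i' ∧ x ∈ P.u j
  · obtain ⟨i, i', hi, hp, x, hx, hx', hj⟩ := h
    obtain ⟨p, h⟩ := hp.exists_cycEdge
    exact ⟨p + 1, Or.inr (P.isPendingAt_of (by simpa using (h 0 (by simp)).symm)
      (by simpa using (h 1 (by simp)).symm) hi hp hx hx' hj)⟩
  · obtain ⟨s, hs⟩ := (mem_edges_iff_cycEdge P.isCycle).mp (P.mem_of_not_pending j h)
    exact ⟨s, Or.inl hs⟩

variable {P}

theorem IsSite.unique {j k : Fin n} {s : ZMod P.C.length} (hj : P.IsSite j s)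
    (hk : P.IsSite k s) : j = k := by
  rcases hj with hj | hj <;> rcases hk with hk | hk
  · exact P.u_injective (hj.symm.trans hk)
  · obtain ⟨m, m', -, -, -, h, -⟩ := hk
    exact absurd (hj.symm.trans h) (P.u_ne_w _ _)
  · obtain ⟨m, m', -, -, -, h, -⟩ := hj
    exact absurd (hk.symm.trans h) (P.u_ne_w _ _)
  · exact hj.unique hk

theorem IsSite.appearance_eq (hn : 4 ≤ n) {j : Fin n} {s : ZMod P.C.length} (hj : P.IsSite j s) :
    appearance P.C (P.u j) = 2 * s.val + 1 ∨ appearance P.C (P.u j) = 2 * s.val := by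
  rcases hj with hj | hj
  · exact Or.inl (hj ▸ appearance_cycEdge P.isCycle s)
  · refine Or.inr (appearance_of_notMem P.isCycle ?_ hj.vert_mem fun r => hj.eq_of_vert_mem hn)
    rw [mem_edges_iff_cycEdge P.isCycle]
    rintro ⟨r, hr⟩
    exact hj.edge_ne hn hr

theorem IsSite.val_lt (hn : 4 ≤ n) {i j : Fin n} {s t : ZMod P.C.length} (hi : P.IsSite i s)
    (hj : P.IsSite j t) (hij : i < j) : s.val < t.val := by
  have := neZero_length P.isCycle
  have hlt : appearance P.C (P.u i) < appearance P.C (P.u j) := P.u_order hij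
  have h1 := hi.appearance_eq hn
  have h2 := hj.appearance_eq hn
  have hne : s.val ≠ t.val := by
    intro h
    obtain rfl := ZMod.val_injective _ h
    exact hij.ne (hi.unique hj)
  omega

theorem IsSite.next_of_val (hn : 4 ≤ n) {i j : Fin n} {s t : ZMod P.C.length} (hi : P.IsSite i s)
    (hj : P.IsSite j t)
    (h : (s.val < t.val ∧ ∀ k r, P.IsSite k r → ¬ (s.val < r.val ∧ r.val < t.val)) ∨
      (t.val < s.val ∧ (∀ k r, P.IsSite k r → ¬ s.val < r.val) ∧
        ∀ k r, P.IsSite k r → ¬ r.val < t.val)) : Next i j := by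
  choose σ hσ using P.exists_isSite
  have eq_of : ∀ {k r}, P.IsSite k r → (σ k).val = r.val := by
    intro k r hk
    -- two sites of the same edge coincide since an edge appears only once
    have h1 := hk.appearance_eq hn
    have h2 := (hσ k).appearance_eq hn
    omega
  refine next_of_strictMono (σ := fun k => (σ k).val)
    (fun a b hab => (hσ a).val_lt hn (hσ b) hab) ?_
  simp only [eq_of hi, eq_of hj]
  exact h.imp (fun h => ⟨h.1, fun k => h.2 k _ (hσ k)⟩)
    (fun h => ⟨h.1, fun k => h.2.1 k _ (hσ k), fun k => h.2.2 k _ (hσ k)⟩)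

theorem IsSite.next_of_succ (hn : 4 ≤ n) {i j : Fin n} {s : ZMod P.C.length} (hi : P.IsSite i s)
    (hj : P.IsSite j (s + 1)) : Next i j := by
  have h3 := three_le_length_of_isCycle P.isCycle
  have := neZero_length P.isCycle
  apply hi.next_of_val hn hj
  rcases zmod_val_add_one (by omega) s with h | ⟨h, h'⟩
  · left
    exact ⟨by omega, fun k r _ => by omega⟩
  · right
    refine ⟨by omega, fun k r _ => ?_, fun k r _ => by omega⟩
    have := r.val_lt
    omega

theorem IsSite.next_of_add_two (hn : 4 ≤ n) {i j : Fin n} {s : ZMod P.C.length}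
    (hi : P.IsSite i s) (hj : P.IsSite j (s + 2)) (h : ∀ k, ¬ P.IsSite k (s + 1)) : Next i j := by
  have h3 := three_le_length_of_isCycle P.isCycle
  have := neZero_length P.isCycle
  have h' : ∀ k r, P.IsSite k r → r.val ≠ (s + 1).val := by
    intro k r hk hr
    rw [ZMod.val_injective _ hr] at hk
    exact h k hk
  apply hi.next_of_val hn hj
  have e : s + 2 = s + 1 + 1 := by ring
  rw [e]
  rcases zmod_val_add_one (by omega) s with h1 | ⟨h1, h1'⟩ <;>
    rcases zmod_val_add_one (by omega) (s + 1) with h2 | ⟨h2, h2'⟩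
  · left
    exact ⟨by omega, fun k r hk => by have := h' k r hk; omega⟩
  · right
    refine ⟨by omega, fun k r hk => ?_, fun k r _ => by omega⟩
    have := h' k r hk
    have := r.val_lt
    omega
  · right
    refine ⟨by omega, fun k r _ => ?_, fun k r hk => ?_⟩
    · have := r.val_lt
      omega
    · have := h' k r hk
      omega
  · omega

/-- A `w`-edge directly after a `u`-edge is not the position of a site. -/
theorem not_isSite_of_u_w {p : ZMod P.C.length} {k : Fin n} {m : Fin P.q} (h1 : P.edge p = P.u k)
    (h2 : P.edge (p + 1) = P.w m) (j : Fin n) : ¬ P.IsSite j (p + 1) := by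
  rintro (h | ⟨a, b, -, -, h, -⟩)
  · exact P.u_ne_w _ _ (h.symm.trans h2)
  · rw [add_sub_cancel_right] at h
    exact P.u_ne_w _ _ (h1.symm.trans h)

variable (P)

theorem w_mem_edgeSet (m : Fin P.q) : P.w m ∈ G.edgeSet := S.edgeSet_subset (P.w_mem m)

theorem u_mem_edgeSet (m : Fin n) : P.u m ∈ G.edgeSet := S.edgeSet_subset (P.u_mem m)

theorem near_of_next (hn : 4 ≤ n) {i j : Fin n} (hij : Next i j) : Near G (P.u i) (P.u j) := by
  suffices ∃ k, Next i k ∧ Near G (P.u i) (P.u k) by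
    obtain ⟨k, hk, h⟩ := this
    rwa [hij.unique hk]
  obtain ⟨s, hs⟩ := P.exists_isSite i
  rcases hs with hs | hs
  · rcases P.edge_eq_w_or_u hn (s + 1) with ⟨m, hm⟩ | ⟨k, hk⟩
    · have e : s + 1 + 1 = s + 2 := by ring
      have hfree := P.not_isSite_of_u_w hs hm
      have m1 : P.vert (s + 1) ∈ P.u i := hs ▸ P.vert_succ_mem_edge s
      have m2 : P.vert (s + 1) ∈ P.w m := hm ▸ P.vert_mem_edge _
      have m3 : P.vert (s + 2) ∈ P.w m := hm ▸ e ▸ P.vert_succ_mem_edge (s + 1)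
      rcases P.edge_eq_w_or_u hn (s + 2) with ⟨m', hm'⟩ | ⟨k, hk⟩
      · obtain ⟨k, hk⟩ := P.exists_isPendingAt hm (e ▸ hm')
        rw [e] at hk
        exact ⟨k, IsSite.next_of_add_two hn (Or.inl hs) (Or.inr hk) hfree,
          P.w m, P.w_mem_edgeSet m, ⟨_, m1, m2⟩, ⟨_, m3, hk.vert_mem⟩⟩
      · exact ⟨k, IsSite.next_of_add_two hn (Or.inl hs) (Or.inl hk) hfree,
          P.w m, P.w_mem_edgeSet m, ⟨_, m1, m2⟩, ⟨_, m3, hk ▸ P.vert_mem_edge _⟩⟩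
    · exact ⟨k, IsSite.next_of_succ hn (Or.inl hs) (Or.inl hk),
        Meets.near (P.u_mem_edgeSet i) ⟨_, hs ▸ P.vert_succ_mem_edge s, hk ▸ P.vert_mem_edge _⟩⟩
  · obtain ⟨a, m, -, -, -, hm, -, m2, m1⟩ := hs.spec
    have m3 : P.vert (s + 1) ∈ P.w m := hm ▸ P.vert_succ_mem_edge s
    rcases P.edge_eq_w_or_u hn (s + 1) with ⟨m', hm'⟩ | ⟨k, hk⟩
    · obtain ⟨k, hk⟩ := P.exists_isPendingAt hm hm'
      exact ⟨k, IsSite.next_of_succ hn (Or.inr hs) (Or.inr hk),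
        P.w m, P.w_mem_edgeSet m, ⟨_, m1, m2⟩, ⟨_, m3, hk.vert_mem⟩⟩
    · exact ⟨k, IsSite.next_of_succ hn (Or.inr hs) (Or.inl hk),
        P.w m, P.w_mem_edgeSet m, ⟨_, m1, m2⟩, ⟨_, m3, hk ▸ P.vert_mem_edge _⟩⟩

/-- A `u`-edge that meets the `w`-edge number `p` has its site directly before, at, or directly
after `p`; in the first case it is an edge of the cycle, and `p` is the site of no `u`-edge. -/
theorem exists_isSite_of_meets_w {i : Fin n} {m : Fin P.q} {p : ZMod P.C.length}
    (hp : P.edge p = P.w m) (h : Meets (P.u i) (P.w m)) :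
    (P.IsSite i (p - 1) ∧ ∀ k, ¬ P.IsSite k p) ∨ P.IsSite i p ∨ P.IsSite i (p + 1) := by
  obtain ⟨s, hs⟩ := P.exists_isSite i
  rcases hs with hs | hs
  · rcases cycEdge_meets P.isCycle (hs.symm ▸ hp.symm ▸ h : Meets (P.edge s) (P.edge p)) with
      rfl | rfl | rfl
    · exact absurd (hs.symm.trans hp) (P.u_ne_w _ _)
    · left
      refine ⟨Or.inl (by rw [add_sub_cancel_right, hs]), P.not_isSite_of_u_w hs hp⟩
    · exact Or.inr (Or.inr (Or.inl hs))
  · rcases hs.eq_of_meets hp h with rfl | rfl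
    · exact Or.inr (Or.inl (Or.inr hs))
    · exact Or.inr (Or.inr (Or.inr (by rwa [sub_add_cancel])))

theorem not_meets_w (hn : 4 ≤ n) {i j : Fin n} (hij : NonConsecutive i j) {m : Fin P.q}
    (hi : Meets (P.u i) (P.w m)) (hj : Meets (P.u j) (P.w m)) : False := by
  obtain ⟨p, hp⟩ := P.exists_edge_eq_w m
  have key : ∀ {a b : Fin n}, P.IsSite a (p - 1) → (∀ k, ¬ P.IsSite k p) → P.IsSite b (p + 1) →
      Next a b := by
    intro a b ha hfree hb
    refine ha.next_of_add_two hn (by convert hb using 1; ring) ?_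
    rwa [sub_add_cancel]
  rcases P.exists_isSite_of_meets_w hp hi with ⟨hi, hf⟩ | hi | hi <;>
    rcases P.exists_isSite_of_meets_w hp hj with ⟨hj, hf'⟩ | hj | hj
  · exact hij.1 (hi.unique hj)
  · exact hf _ hj
  · exact hij.2.1 (key hi hf hj)
  · exact hf' _ hi
  · exact hij.1 (hi.unique hj)
  · exact hij.2.1 (hi.next_of_succ hn hj)
  · exact hij.2.2 (key hj hf' hi)
  · exact hij.2.2 (hj.next_of_succ hn hi)
  · exact hij.1 (hi.unique hj)

variable {P}

/-- A pending edge meets no other `u`-edge. -/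
theorem IsPendingAt.not_meets_u (hn : 4 ≤ n) {j k : Fin n} {s : ZMod P.C.length}
    (hj : P.IsPendingAt j s) (hjk : j ≠ k) : ¬ Meets (P.u j) (P.u k) := by
  intro h
  obtain ⟨t, hk | hk⟩ := P.exists_isSite k
  · obtain ⟨x, hx, hx'⟩ := h
    obtain ⟨r, rfl, hr⟩ := exists_cycVert_of_mem (hk ▸ hx' : x ∈ P.edge t)
    obtain rfl := hj.eq_of_vert_mem hn hx
    obtain ⟨m, m', -, -, h1, h2, -⟩ := hj
    rcases hr with rfl | rfl
    · exact P.u_ne_w _ _ (hk.symm.trans h2)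
    · rw [add_sub_cancel_right] at h1
      exact P.u_ne_w _ _ (hk.symm.trans h1)
  · exact P.pending_disjoint j k hjk hj.exists_pending hk.exists_pending h

variable (P)

theorem not_meets_u (hn : 4 ≤ n) {i j k : Fin n} (hij : i ≠ j) (hki : k ≠ i) (hkj : k ≠ j)
    (hi : Meets (P.u k) (P.u i)) (hj : Meets (P.u k) (P.u j)) : False := by
  have hC := P.isCycle
  obtain ⟨p, hp | hp⟩ := P.exists_isSite k
  swap
  · exact hp.not_meets_u hn hki hi
  obtain ⟨r, hr | hr⟩ := P.exists_isSite i
  swap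
  · exact hr.not_meets_u hn hki.symm hi.symm
  obtain ⟨s, hs | hs⟩ := P.exists_isSite j
  swap
  · exact hs.not_meets_u hn hkj.symm hj.symm
  have key : ∀ {a b : Fin n} {t}, P.edge (t + 1) = P.u k → P.edge t = P.u a →
      P.edge (t + 1 + 1) = P.u b → False := by
    intro a b t h1 h2 h3
    refine P.not_three_u hn h2 h1 (k := b) (by rw [← h3]; congr 1; ring)
  rcases cycEdge_meets hC (hp.symm ▸ hr.symm ▸ hi : Meets (P.edge p) (P.edge r)) with
      h1 | h1 | h1 <;>
    rcases cycEdge_meets hC (hp.symm ▸ hs.symm ▸ hj : Meets (P.edge p) (P.edge s)) with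
      h2 | h2 | h2
  · exact hki (P.u_injective (by rw [← hp, ← hr, h1]))
  · exact hki (P.u_injective (by rw [← hp, ← hr, h1]))
  · exact hki (P.u_injective (by rw [← hp, ← hr, h1]))
  · exact hkj (P.u_injective (by rw [← hp, ← hs, h2]))
  · exact hij (P.u_injective (by rw [← hr, ← hs, h1, h2]))
  · subst h1 h2
    exact key hp hs hr
  · exact hkj (P.u_injective (by rw [← hp, ← hs, h2]))
  · subst h1 h2
    exact key hp hr hs
  · exact hij (P.u_injective (by rw [← hr, ← hs, add_right_cancel (h1.symm.trans h2)]))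

theorem not_near_of_nonConsecutive (hn : 4 ≤ n) (hS : S.IsInduced) (hP : P.IsFertile)
    {i j : Fin n} (hij : NonConsecutive i j) : ¬ Near G (P.u i) (P.u j) := by
  rintro ⟨g, hg, h1, h2⟩
  have hdisj := P.u_disjoint i j hij
  by_cases hw : ∃ m, P.w m = g
  · obtain ⟨m, rfl⟩ := hw
    exact P.not_meets_w hn hij h1 h2.symm
  by_cases hu : ∃ k, P.u k = g
  · obtain ⟨k, rfl⟩ := hu
    refine P.not_meets_u hn hij.1 ?_ ?_ h1.symm h2
    · rintro rfl; exact hdisj h2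
    · rintro rfl; exact hdisj h1
  have hgS : g ∈ S.edgeSet := by
    obtain ⟨x, hx, hxg⟩ := h1
    obtain ⟨y, hyg, hy⟩ := h2
    have hxy : x ≠ y := by rintro rfl; exact hdisj ⟨_, hx, hy⟩
    obtain rfl := (Sym2.mem_and_mem_iff hxy).mp ⟨hxg, hyg⟩
    exact hS (S.mem_verts_of_mem_edge (P.u_mem i) hx) (S.mem_verts_of_mem_edge (P.u_mem j) hy) hg
  exact hP g ⟨hgS, by rintro (h | h); exacts [hu h, hw h]⟩ i j hij ⟨h1.symm, h2⟩

end Sprout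

/-! ### Walks along sequences that may stand still -/

section Lists

variable {α : Type*} {p : ℕ → Prop} [DecidablePred p]

/-- Among the numbers satisfying `p`, the number `k` is preceded by `Nat.count p k` others. -/
theorem filter_range_getElem? {k m : ℕ} (hk : p k) (hkm : k < m) :
    ((List.range m).filter p)[Nat.count p k]? = some k := by
  have h1 : List.range m = List.range k ++ k :: List.range' (k + 1) (m - k - 1) := by
    rw [← List.range'_succ, List.range_eq_range', List.range_eq_range']
    have := List.range'_append_1 (s := 0) (m := k) (n := m - k - 1 + 1)
    rw [zero_add] at this
    rw [this]
    congr 1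
    omega
  have h2 : ((List.range k).filter p).length = Nat.count p k := by
    rw [Nat.count, List.countP_eq_length_filter]
  rw [h1, List.filter_append, List.getElem?_append_right (by omega), h2, Nat.sub_self,
    List.filter_cons_of_pos (by simpa using hk)]
  simp

theorem exists_count_eq {r m : ℕ} (h : r < Nat.count p m) :
    ∃ k < m, p k ∧ Nat.count p k = r := by
  induction m with
  | zero => simp at h
  | succ m ih =>
    by_cases hr : r < Nat.count p m
    · obtain ⟨k, hk, h⟩ := ih hr
      exact ⟨k, by omega, h⟩
    · rw [Nat.count_succ] at h
      split_ifs at h with hp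
      · exact ⟨m, by omega, hp, by omega⟩
      · omega

/-- Listing the values of a periodic sequence over a shifted period amounts to a rotation. -/
theorem exists_prefix_rotate {e : ℕ → α} {N s : ℕ} (hp : ∀ k, p (k + N) ↔ p k)
    (he : ∀ k, e (k + N) = e k) (hs : s ≤ N) {l : List α}
    (h : l <+: ((List.range' s N).filter p).map e) :
    ∃ k, l <+: (((List.range N).filter p).map e).rotate k := by
  have h1 : List.range N = List.range' 0 s ++ List.range' s (N - s) := by
    rw [List.range_eq_range']
    have := List.range'_append_1 (s := 0) (m := s) (n := N - s)
    rw [zero_add] at this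
    rw [this]
    congr 1
    omega
  have h2 : List.range' s N = List.range' s (N - s) ++ (List.range' 0 s).map (· + N) := by
    have h3 := List.range'_append_1 (s := s) (m := N - s) (n := s)
    have h4 : s + (N - s) = N := by omega
    have h5 : N - s + s = N := by omega
    rw [h4, h5] at h3
    rw [← h3]
    congr 1
    have := List.map_add_range' (a := N) (s := 0) (n := s) (step := 1)
    simp only [add_comm N, zero_add] at this
    exact this.symm
  have h6 : ((List.range' 0 s).map (· + N)).filter p =
      ((List.range' 0 s).filter p).map (· + N) := by
    rw [List.filter_map]
    congr 1
    refine List.filter_congr fun k _ => ?_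
    simp [hp]
  have h7 : ((List.range' s N).filter p).map e =
      (((List.range N).filter p).map e).rotate (((List.range' 0 s).filter p).map e).length := by
    rw [h1, h2]
    simp only [List.filter_append, List.map_append, h6, List.map_map]
    rw [List.rotate_append_length_eq]
    congr 2
    funext k
    exact he k
  exact ⟨_, h7 ▸ h⟩

end Lists

section Stutter

open scoped Classical

variable {G : SimpleGraph V} {v : ℕ → V}

/-- The sequence `v` changes its value after the time `k`. -/
def Moves (v : ℕ → V) (k : ℕ) : Prop := v k ≠ v (k + 1)

/-- A sequence of vertices each of which is equal or adjacent to the next one gives a walk, which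
uses exactly the steps at which the sequence moves. -/
theorem exists_walk_of_moves (h : ∀ k, Moves v k → G.Adj (v k) (v (k + 1))) (m : ℕ) :
    ∀ y, v m = y → ∃ C : G.Walk (v 0) y,
      C.edges = ((List.range m).filter (Moves v)).map (fun k => s(v k, v (k + 1))) ∧
      C.support = v 0 :: ((List.range m).filter (Moves v)).map (fun k => v (k + 1)) := by
  induction m with
  | zero => rintro y rfl; exact ⟨.nil, by simp, by simp⟩
  | succ m ih =>
    rintro y rfl
    obtain ⟨C, h1, h2⟩ := ih _ rfl
    by_cases hm : Moves v m
    · refine ⟨C.concat (h m hm), ?_, ?_⟩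
      · rw [SimpleGraph.Walk.edges_concat, h1, List.range_succ, List.filter_append]
        simp [hm]
      · rw [SimpleGraph.Walk.support_concat, h2, List.range_succ, List.filter_append]
        simp [hm]
    · have he : v m = v (m + 1) := by simpa [Moves] using hm
      refine ⟨C.copy rfl he, ?_, ?_⟩
      · rw [SimpleGraph.Walk.edges_copy, h1, List.range_succ, List.filter_append]
        simp [hm]
      · rw [SimpleGraph.Walk.support_copy, h2, List.range_succ, List.filter_append]
        simp [hm]

theorem support_getElem?_count {m : ℕ} (k : ℕ) (hk : k ≤ m) :
    (v 0 :: ((List.range m).filter (Moves v)).map (fun k => v (k + 1)))[Nat.count (Moves v) k]? =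
      some (v k) := by
  induction k with
  | zero => simp
  | succ k ih =>
    by_cases h : Moves v k
    · rw [Nat.count_succ, if_pos h, List.getElem?_cons_succ, List.getElem?_map,
        filter_range_getElem? h hk]
      rfl
    · have he : v k = v (k + 1) := by simpa [Moves] using h
      rw [Nat.count_succ, if_neg h, add_zero, ih (by omega), he]

end Stutter

section Cycle

variable {G : SimpleGraph V} {c : V} {C : G.Walk c c}

/-- The edge that directly follows a given edge on a cycle is unique. -/
theorem IsPartOf.unique_next (hC : C.IsCycle) {x y z : Sym2 V} {l l' : List (Sym2 V)}
    (h : IsPartOf (x :: y :: l) C) (h' : IsPartOf (x :: z :: l') C) : y = z := by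
  obtain ⟨p, hp⟩ := h.exists_cycEdge
  obtain ⟨r, hr⟩ := h'.exists_cycEdge
  have h1 : x = cycEdge C (p + (0 : ℕ)) := hp 0 (by simp)
  have h2 : x = cycEdge C (r + (0 : ℕ)) := hr 0 (by simp)
  obtain rfl := add_right_cancel (cycEdge_injective hC (h1.symm.trans h2))
  have h3 : y = cycEdge C (p + (1 : ℕ)) := hp 1 (by simp)
  have h4 : z = cycEdge C (p + (1 : ℕ)) := hr 1 (by simp)
  exact h3.trans h4.symm

end Cycle

/-! ### Rings of edges -/

theorem zmod_natCast_ne_zero {n a : ℕ} (h0 : 0 < a) (h : a < n) : (a : ZMod n) ≠ 0 := by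
  rw [ne_eq, ZMod.natCast_eq_zero_iff]
  exact fun hd => absurd (Nat.le_of_dvd h0 hd) (by omega)

/-- A cyclic sequence of at least four edges of which only consecutive ones are near each other. -/
structure EdgeRing (G : SimpleGraph V) (n : ℕ) where
  /-- the edges -/
  u : ZMod n → Sym2 V
  four_le : 4 ≤ n
  u_mem : ∀ i, u i ∈ G.edgeSet
  u_injective : Function.Injective u
  eq_of_near : ∀ i j, Near G (u i) (u j) → j = i ∨ j = i + 1 ∨ i = j + 1

namespace EdgeRing

section Basic

variable {G : SimpleGraph V} {n : ℕ} (D : EdgeRing G n)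

theorem one_ne_zero (D : EdgeRing G n) : (1 : ZMod n) ≠ 0 := by
  have := D.four_le
  exact_mod_cast zmod_natCast_ne_zero (n := n) one_pos (by omega)

theorem two_ne_zero (D : EdgeRing G n) : (2 : ZMod n) ≠ 0 := by
  have := D.four_le
  exact_mod_cast zmod_natCast_ne_zero (n := n) Nat.two_pos (by omega)

theorem three_ne_zero (D : EdgeRing G n) : (3 : ZMod n) ≠ 0 := by
  have := D.four_le
  exact_mod_cast zmod_natCast_ne_zero (n := n) (a := 3) (by omega) (by omega)

/-- The edge number `i` meets the next one. -/
def Touch (i : ZMod n) : Prop := Meets (D.u i) (D.u (i + 1))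

variable {D}

theorem not_near_add_two {i : ZMod n} : ¬ Near G (D.u i) (D.u (i + 2)) := by
  intro h
  rcases D.eq_of_near _ _ h with h | h | h
  · exact D.two_ne_zero (by linear_combination h)
  · exact D.one_ne_zero (by linear_combination h)
  · exact D.three_ne_zero (by linear_combination -h)

theorem Touch.not_succ {i : ZMod n} (h : D.Touch i) : ¬ D.Touch (i + 1) := by
  intro h'
  have e : i + 1 + 1 = i + 2 := by ring
  rw [Touch, e] at h'
  exact not_near_add_two ⟨_, D.u_mem _, h, h'⟩

/-- Edges of the ring that meet are consecutive. -/
theorem touch_of_meets {i j : ZMod n} (hij : i ≠ j) (h : Meets (D.u i) (D.u j)) :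
    (j = i + 1 ∧ D.Touch i) ∨ (i = j + 1 ∧ D.Touch j) := by
  rcases D.eq_of_near _ _ (h.near (D.u_mem i)) with rfl | rfl | rfl
  · exact absurd rfl hij
  · exact Or.inl ⟨rfl, h⟩
  · exact Or.inr ⟨rfl, h.symm⟩

/-- An edge of the graph that meets two consecutive edges of the ring meets no other one. -/
theorem eq_or_eq_of_meets {i j : ZMod n} {g : Sym2 V} (hg : g ∈ G.edgeSet) (h1 : Meets (D.u i) g)
    (h2 : Meets g (D.u (i + 1))) (h : Meets (D.u j) g) : j = i ∨ j = i + 1 := by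
  have near1 := D.eq_of_near j i ⟨g, hg, h, h1.symm⟩
  have near2 := D.eq_of_near j (i + 1) ⟨g, hg, h, h2⟩
  rcases near1 with h1 | h1 | h1
  · exact Or.inl h1.symm
  · rcases near2 with h2 | h2 | h2
    · exact Or.inr h2.symm
    · exact absurd (by linear_combination h2 - h1) D.one_ne_zero
    · exact absurd (by linear_combination -h1 - h2) D.three_ne_zero
  · exact Or.inr h1

end Basic

end EdgeRing

/-- A ring of edges together with a way of passing from each edge to the next: the edge number `i`
is entered at `a i` and left at `b i`. If it meets the next edge then it is left at the common
vertex, and otherwise along an edge of the graph. The last edge does not meet the first. -/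
structure LinkedRing (G : SimpleGraph V) (n : ℕ) extends EdgeRing G n where
  /-- the vertex at which an edge is entered -/
  a : ZMod n → V
  /-- the vertex at which an edge is left -/
  b : ZMod n → V
  a_mem : ∀ i, a i ∈ u i
  b_mem : ∀ i, b i ∈ u i
  link_eq : ∀ i, toEdgeRing.Touch i → b i = a (i + 1)
  link_adj : ∀ i, ¬ toEdgeRing.Touch i → G.Adj (b i) (a (i + 1))
  not_touch_last : ¬ toEdgeRing.Touch (-1)

theorem EdgeRing.exists_linkedRing {G : SimpleGraph V} {n : ℕ} (D : EdgeRing G n)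
    (hnear : ∀ i, Near G (D.u i) (D.u (i + 1))) : Nonempty (LinkedRing G n) := by
  -- one of two consecutive pairs does not meet; the numbering is made to start there
  obtain ⟨D, hnear, hlast⟩ : ∃ D : EdgeRing G n, (∀ i, Near G (D.u i) (D.u (i + 1))) ∧
      ¬ D.Touch (-1) := by
    by_cases h : D.Touch (-1)
    · refine ⟨⟨fun i => D.u (i + 1), D.four_le, fun i => D.u_mem _,
        fun i j hij => add_right_cancel (D.u_injective hij), fun i j hij => ?_⟩,
        fun i => hnear _, ?_⟩
      · rcases D.eq_of_near _ _ hij with h | h | h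
        · exact Or.inl (add_right_cancel h)
        · exact Or.inr (Or.inl (add_right_cancel h))
        · exact Or.inr (Or.inr (add_right_cancel h))
      · exact h.not_succ
    · exact ⟨D, hnear, h⟩
  have key : ∀ i, ∃ x y, x ∈ D.u i ∧ y ∈ D.u (i + 1) ∧ (D.Touch i → x = y) ∧
      (¬ D.Touch i → G.Adj x y) := by
    intro i
    by_cases h : D.Touch i
    · obtain ⟨x, hx, hy⟩ := h
      exact ⟨x, x, hx, hy, fun _ => rfl, fun h => absurd ⟨x, hx, hy⟩ h⟩
    · obtain ⟨g, hg, ⟨x, hx, hx'⟩, ⟨y, hy', hy⟩⟩ := hnear i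
      have hxy : x ≠ y := by rintro rfl; exact h ⟨x, hx, hy⟩
      refine ⟨x, y, hx, hy, fun h' => absurd h' h, fun _ => ?_⟩
      obtain rfl := (Sym2.mem_and_mem_iff hxy).mp ⟨hx', hy'⟩
      exact hg
  choose b a hb ha h1 h2 using key
  refine ⟨{
    toEdgeRing := D
    a := fun i => a (i - 1)
    b := b
    a_mem := fun i => ?_
    b_mem := hb
    link_eq := fun i h => ?_
    link_adj := fun i h => ?_
    not_touch_last := hlast }⟩
  · have := ha (i - 1)
    rwa [sub_add_cancel] at this
  · rw [add_sub_cancel_right]; exact h1 i h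
  · rw [add_sub_cancel_right]; exact h2 i h

namespace LinkedRing

variable {G : SimpleGraph V} {n : ℕ} (R : LinkedRing G n)

/-- The edge `i` of the ring meets the next one. -/
abbrev Touch (i : ZMod n) : Prop := R.toEdgeRing.Touch i

/-- The edge from the exit of the edge number `i` to the entry of the next one. -/
def link (i : ZMod n) : Sym2 V := s(R.b i, R.a (i + 1))

theorem b_mem_link (i : ZMod n) : R.b i ∈ R.link i := by simp [link]

theorem a_mem_link (i : ZMod n) : R.a (i + 1) ∈ R.link i := by simp [link]

theorem meets_link (i : ZMod n) : Meets (R.u i) (R.link i) := ⟨_, R.b_mem i, R.b_mem_link i⟩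

theorem link_meets (i : ZMod n) : Meets (R.link i) (R.u (i + 1)) :=
  ⟨_, R.a_mem_link i, R.a_mem _⟩

variable {R}

theorem link_mem {i : ZMod n} (h : ¬ R.Touch i) : R.link i ∈ G.edgeSet := R.link_adj i h

theorem eq_of_meets_link {i j : ZMod n} (hi : ¬ R.Touch i) (h : Meets (R.u j) (R.link i)) :
    j = i ∨ j = i + 1 :=
  EdgeRing.eq_or_eq_of_meets (link_mem hi) (R.meets_link i) (R.link_meets i) h

theorem b_ne_a {i : ZMod n} (h : ¬ R.Touch i) : R.b i ≠ R.a (i + 1) := (R.link_adj i h).ne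

theorem u_eq {i : ZMod n} (h : R.a i ≠ R.b i) : R.u i = s(R.a i, R.b i) :=
  (Sym2.mem_and_mem_iff h).mp ⟨R.a_mem i, R.b_mem i⟩

/-- If `a i = b i`, the link before an edge that meets the next one would meet this next one. -/
theorem a_ne_b_of_touch {i : ZMod n} (h : R.Touch i) : R.a i ≠ R.b i := by
  intro hab
  have h' : ¬ R.Touch (i - 1) := fun h' => h'.not_succ (by rwa [sub_add_cancel])
  have hm : Meets (R.u (i + 1)) (R.link (i - 1)) := by
    refine ⟨R.a i, ?_, ?_⟩
    · rw [hab, R.link_eq i h]; exact R.a_mem _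
    · have := R.a_mem_link (i - 1)
      rwa [sub_add_cancel] at this
  rcases eq_of_meets_link h' hm with h | h
  · exact R.two_ne_zero (by linear_combination h)
  · exact R.one_ne_zero (by linear_combination h)

theorem a_ne_b_succ_of_touch {i : ZMod n} (h : R.Touch i) : R.a (i + 1) ≠ R.b (i + 1) := by
  intro hab
  have hm : Meets (R.u i) (R.link (i + 1)) :=
    ⟨R.b i, R.b_mem i, by rw [R.link_eq i h, hab]; exact R.b_mem_link _⟩
  rcases eq_of_meets_link h.not_succ hm with h | h
  · exact R.one_ne_zero (by linear_combination -h)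
  · exact R.two_ne_zero (by linear_combination -h)

theorem link_injective {i j : ZMod n} (hi : ¬ R.Touch i) (hj : ¬ R.Touch j)
    (h : R.link i = R.link j) : i = j := by
  rcases eq_of_meets_link hj (h ▸ R.meets_link i) with h1 | h1
  · exact h1
  rcases eq_of_meets_link hi (h ▸ R.meets_link j) with h2 | h2
  · exact h2.symm
  · exact absurd (by linear_combination -h1 - h2) R.two_ne_zero

theorem u_ne_link {i j : ZMod n} (hj : ¬ R.Touch j) : R.u i ≠ R.link j := by
  intro h
  have hm : Meets (R.u i) (R.link j) := by rw [← h]; exact meets_self _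
  rcases eq_of_meets_link hj hm with rfl | rfl
  · have := R.link_meets i
    rw [← h] at this
    exact hj this
  · have := R.meets_link j
    rw [← h] at this
    exact hj this

/-- Two distinct edges have at most one common vertex. -/
theorem eq_b_of_mem {i : ZMod n} (h : R.Touch i) {x : V} (hx : x ∈ R.u i)
    (hx' : x ∈ R.u (i + 1)) : x = R.b i := by
  by_contra hne
  have h1 := (Sym2.mem_and_mem_iff hne).mp ⟨hx, R.b_mem i⟩
  have h2 := (Sym2.mem_and_mem_iff hne).mp ⟨hx', R.link_eq i h ▸ R.a_mem _⟩
  have := R.u_injective (h1.trans h2.symm)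
  exact R.one_ne_zero (by linear_combination -this)

variable (R)

/-- The closed sequence of vertices `a 0, b 0, a 1, b 1, …`. It stays where it is from `a i` to
`b i` if these are equal, and from `b i` to `a (i + 1)` if the edges `i` and `i + 1` meet. -/
def seq (k : ℕ) : V := if k % 2 = 0 then R.a (k / 2 : ℕ) else R.b (k / 2 : ℕ)

theorem seq_even (i : ℕ) : R.seq (2 * i) = R.a i := by
  rw [seq, if_pos (by omega), Nat.mul_div_cancel_left _ Nat.two_pos]

theorem seq_odd (i : ℕ) : R.seq (2 * i + 1) = R.b i := by
  rw [seq, if_neg (by omega)]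
  congr 2
  omega

theorem seq_add_period (k : ℕ) : R.seq (k + 2 * n) = R.seq k := by
  have h1 : (k + 2 * n) % 2 = k % 2 := by omega
  have h2 : (k + 2 * n) / 2 = k / 2 + n := by omega
  rw [seq, seq, h1, h2]
  simp

theorem seq_mem (k : ℕ) : R.seq k ∈ R.u (k / 2 : ℕ) := by
  rw [seq]
  split_ifs
  · exact R.a_mem _
  · exact R.b_mem _

/-- The edge number `k` of the sequence `seq`, provided that the sequence moves. -/
def step (k : ℕ) : Sym2 V := s(R.seq k, R.seq (k + 1))

theorem moves_even {i : ℕ} : Moves R.seq (2 * i) ↔ R.a i ≠ R.b i := by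
  rw [Moves, seq_even, seq_odd]

theorem moves_odd {i : ℕ} : Moves R.seq (2 * i + 1) ↔ ¬ R.Touch i := by
  have e : 2 * i + 1 + 1 = 2 * (i + 1) := by ring
  rw [Moves, seq_odd, e, seq_even, Nat.cast_succ]
  exact ⟨fun h h' => h (R.link_eq _ h'), fun h => b_ne_a h⟩

theorem step_odd (i : ℕ) : R.step (2 * i + 1) = R.link i := by
  have e : 2 * i + 1 + 1 = 2 * (i + 1) := by ring
  rw [step, seq_odd, e, seq_even, link, Nat.cast_succ]

theorem step_even {i : ℕ} (h : R.a i ≠ R.b i) : R.step (2 * i) = R.u i := by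
  rw [step, seq_even, seq_odd, u_eq h]

theorem moves_add_period (k : ℕ) : Moves R.seq (k + 2 * n) ↔ Moves R.seq k := by
  have e : k + 2 * n + 1 = k + 1 + 2 * n := by ring
  rw [Moves, e, seq_add_period, seq_add_period, Moves]

theorem step_add_period (k : ℕ) : R.step (k + 2 * n) = R.step k := by
  have e : k + 2 * n + 1 = k + 1 + 2 * n := by ring
  rw [step, e, seq_add_period, seq_add_period, step]

theorem adj_of_moves (k : ℕ) (h : Moves R.seq k) : G.Adj (R.seq k) (R.seq (k + 1)) := by
  obtain ⟨i, rfl | rfl⟩ := Nat.even_or_odd' k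
  · have h1 := R.moves_even.mp h
    have := R.u_mem i
    rw [u_eq h1] at this
    rwa [seq_even, seq_odd]
  · have := R.link_adj i (R.moves_odd.mp h)
    have e : 2 * i + 1 + 1 = 2 * (i + 1) := by ring
    rwa [seq_odd, e, seq_even, Nat.cast_succ]

theorem natCast_injOn {i j : ℕ} (hi : i < n) (hj : j < n) (h : (i : ZMod n) = j) : i = j := by
  rw [ZMod.natCast_eq_natCast_iff', Nat.mod_eq_of_lt hi, Nat.mod_eq_of_lt hj] at h
  exact h

theorem step_injOn {k k' : ℕ} (hk : k < 2 * n) (hk' : k' < 2 * n) (h : Moves R.seq k)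
    (h' : Moves R.seq k') (he : R.step k = R.step k') : k = k' := by
  obtain ⟨i, rfl | rfl⟩ := Nat.even_or_odd' k <;> obtain ⟨j, rfl | rfl⟩ := Nat.even_or_odd' k'
  · rw [moves_even] at h h'
    rw [step_even _ h, step_even _ h'] at he
    rw [natCast_injOn (by omega) (by omega) (R.u_injective he)]
  · rw [moves_even] at h
    rw [moves_odd] at h'
    rw [step_even _ h, step_odd] at he
    exact absurd he (u_ne_link h')
  · rw [moves_odd] at h
    rw [moves_even] at h'
    rw [step_even _ h', step_odd] at he
    exact absurd he.symm (u_ne_link h)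
  · rw [moves_odd] at h h'
    rw [step_odd, step_odd] at he
    rw [natCast_injOn (by omega) (by omega) (link_injective h h' he)]

theorem natCast_eq_of_le {i j : ℕ} (hij : i ≤ j) (hj : j ≤ n + 1) (h : (i : ZMod n) = j) :
    j = i ∨ (i = 0 ∧ j = n) ∨ (i = 1 ∧ j = n + 1) ∨ n ≤ 1 := by
  have h1 : (((j - i : ℕ) : ℤ) : ZMod n) = 0 := by
    push_cast [Nat.cast_sub hij]
    rw [h, sub_self]
  have h2 : ((j - i : ℕ) : ZMod n) = 0 := by exact_mod_cast h1
  rw [ZMod.natCast_eq_zero_iff] at h2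
  obtain ⟨c, hc⟩ := h2
  rcases c with _ | _ | c
  · simp at hc; omega
  · simp at hc; omega
  · have : n * (c + 1 + 1) = n * c + 2 * n := by ring
    have : 0 ≤ n * c := Nat.zero_le _
    omega

/-- The sequence does not return to a vertex that it has left, except when it closes. -/
theorem seq_succ_injOn {k k' : ℕ} (hkk : k < k') (hk' : k' < 2 * n) (h : Moves R.seq k)
    (h' : Moves R.seq k') : R.seq (k + 1) ≠ R.seq (k' + 1) := by
  intro he
  have hn := R.four_le
  have m1 := R.seq_mem (k + 1)
  have m2 := R.seq_mem (k' + 1)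
  by_cases hij : (((k + 1) / 2 : ℕ) : ZMod n) = ((k' + 1) / 2 : ℕ)
  · -- both vertices lie on the same edge of the ring
    rcases natCast_eq_of_le (by omega) (by omega) hij with h1 | ⟨h1, h2⟩ | h1 | h1
    · obtain ⟨i, rfl | rfl⟩ := Nat.even_or_odd' k'
      · have e : k + 1 = 2 * i := by omega
        exact h' (e ▸ he)
      · omega
    · obtain rfl : k = 0 := by omega
      obtain rfl : k' = 2 * n - 1 := by omega
      apply h
      have e : 2 * n - 1 + 1 = 0 + 2 * n := by omega
      rw [he, e, seq_add_period]
    · omega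
    · omega
  rcases EdgeRing.touch_of_meets hij ⟨_, m1, he ▸ m2⟩ with ⟨h1, ht⟩ | ⟨h1, ht⟩
  · -- the second vertex lies on the next edge of the ring
    have hx := eq_b_of_mem ht m1 (by rw [← h1, he]; exact m2)
    have hk1 : k + 1 = 2 * ((k + 1) / 2) + 1 := by
      by_contra hc
      have e : k + 1 = 2 * ((k + 1) / 2) := by omega
      rw [e, seq_even, ← e] at hx
      exact a_ne_b_of_touch ht hx
    have hk2 : k' + 1 = 2 * ((k' + 1) / 2) := by
      by_contra hc
      have e : k' + 1 = 2 * ((k' + 1) / 2) + 1 := by omega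
      have hb := R.seq_odd ((k' + 1) / 2)
      rw [← e, ← he, hx, R.link_eq _ ht, ← h1] at hb
      have := a_ne_b_succ_of_touch ht
      rw [← h1] at this
      exact this hb
    rw [← Nat.cast_succ] at h1
    have hle : (k + 1) / 2 + 1 ≤ (k' + 1) / 2 := by omega
    rcases natCast_eq_of_le hle (by omega) h1.symm with h2 | h2 | h2 | h2
    · have e : k' = 2 * ((k + 1) / 2) + 1 := by omega
      rw [e] at h'
      exact (R.moves_odd.mp h') ht
    · omega
    · omega
    · omega
  · -- the first vertex lies on the next edge of the ring
    rw [← Nat.cast_succ] at h1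
    rcases natCast_eq_of_le (i := (k + 1) / 2) (j := (k' + 1) / 2 + 1) (by omega) (by omega) h1 with
      h2 | ⟨h2, h3⟩ | ⟨h2, h3⟩ | h2
    · omega
    · apply R.not_touch_last
      have e : (((k' + 1) / 2 : ℕ) : ZMod n) = -1 := by
        have : (((k' + 1) / 2 + 1 : ℕ) : ZMod n) = 0 := by rw [h3]; simp
        push_cast at this ⊢
        linear_combination this
      rwa [e] at ht
    · have hx := eq_b_of_mem ht m2 (by rw [← Nat.cast_succ, ← h1, ← he]; exact m1)
      have e : k' + 1 = 2 * ((k' + 1) / 2) := by omega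
      have ha := R.seq_even ((k' + 1) / 2)
      rw [← e, hx] at ha
      exact a_ne_b_of_touch ht ha.symm
    · omega

end LinkedRing

/-! ### The cycle of a linked ring -/

namespace LinkedRing

open scoped Classical

variable {G : SimpleGraph V} {n : ℕ} (R : LinkedRing G n)

/-- The edges of the cycle along the sequence `seq`. -/
noncomputable def cycleEdges : List (Sym2 V) :=
  ((List.range (2 * n)).filter (Moves R.seq)).map R.step

theorem exists_isCycle : ∃ C : G.Walk (R.seq 0) (R.seq 0), C.IsCycle ∧ C.edges = R.cycleEdges ∧
    C.support =
      R.seq 0 :: ((List.range (2 * n)).filter (Moves R.seq)).map (fun k => R.seq (k + 1)) := by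
  have hn := R.four_le
  have hper : R.seq (2 * n) = R.seq 0 := by
    have := R.seq_add_period 0
    rwa [zero_add] at this
  obtain ⟨C, h1, h2⟩ := exists_walk_of_moves R.adj_of_moves (2 * n) _ hper
  refine ⟨C, ?_, h1, h2⟩
  have hnodup := (List.nodup_range (n := 2 * n)).filter (Moves R.seq)
  rw [SimpleGraph.Walk.isCycle_def]
  refine ⟨⟨?_⟩, ?_, ?_⟩
  · rw [h1]
    refine hnodup.map_on fun k hk k' hk' h => ?_
    simp only [List.mem_filter, List.mem_range, decide_eq_true_eq] at hk hk'
    exact R.step_injOn hk.1 hk'.1 hk.2 hk'.2 h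
  · rintro rfl
    have h0 : (List.range (2 * n)).filter (Moves R.seq) = [] := by simpa using h1.symm
    rw [List.filter_eq_nil_iff] at h0
    by_cases hab : R.a ((0 : ℕ) : ZMod n) = R.b ((0 : ℕ) : ZMod n)
    · refine h0 (2 * 0 + 1) (by simp; omega) ?_
      simp only [decide_eq_true_eq]
      rw [moves_odd]
      exact fun h => a_ne_b_of_touch h hab
    · refine h0 (2 * 0) (by simp; omega) ?_
      simp only [decide_eq_true_eq]
      rwa [moves_even]
  · rw [h2, List.tail_cons]
    refine hnodup.map_on fun k hk k' hk' h => ?_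
    simp only [List.mem_filter, List.mem_range, decide_eq_true_eq] at hk hk'
    rcases lt_trichotomy k k' with hlt | rfl | hlt
    · exact absurd h (R.seq_succ_injOn hlt hk'.1 hk.2 hk'.2)
    · rfl
    · exact absurd h.symm (R.seq_succ_injOn hlt hk.1 hk'.2 hk.2)

section Cycle

variable {R} {C : G.Walk (R.seq 0) (R.seq 0)}

theorem length_eq (hE : C.edges = R.cycleEdges) :
    C.length = Nat.count (Moves R.seq) (2 * n) := by
  rw [← SimpleGraph.Walk.length_edges, hE, cycleEdges, List.length_map, Nat.count,
    List.countP_eq_length_filter]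

theorem count_lt {k : ℕ} (hk : k < 2 * n) (h : Moves R.seq k) :
    Nat.count (Moves R.seq) k < Nat.count (Moves R.seq) (2 * n) :=
  Nat.count_strict_mono h hk

theorem cycEdge_count (hE : C.edges = R.cycleEdges) {k : ℕ} (hk : k < 2 * n)
    (h : Moves R.seq k) : cycEdge C (Nat.count (Moves R.seq) k : ℕ) = R.step k := by
  have hlt := count_lt hk h
  have hlt' : Nat.count (Moves R.seq) k < C.edges.length := by
    rwa [SimpleGraph.Walk.length_edges, length_eq hE]
  rw [cycEdge_natCast _ hlt', List.getElem_eq_iff, hE, cycleEdges, List.getElem?_map,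
    filter_range_getElem? h hk]
  rfl

theorem cycVert_count (hE : C.edges = R.cycleEdges)
    (hS : C.support =
      R.seq 0 :: ((List.range (2 * n)).filter (Moves R.seq)).map (fun k => R.seq (k + 1)))
    {k : ℕ} (hk : k ≤ 2 * n) : cycVert C (Nat.count (Moves R.seq) k : ℕ) = R.seq k := by
  have hle : Nat.count (Moves R.seq) k ≤ C.length := by
    rw [length_eq hE]; exact Nat.count_monotone _ hk
  rw [cycVert_natCast _ hle, SimpleGraph.Walk.getVert_eq_support_getElem _ hle,
    List.getElem_eq_iff, hS, support_getElem?_count k hk]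

theorem step_mem_edges (hE : C.edges = R.cycleEdges) {k : ℕ} (hk : k < 2 * n)
    (h : Moves R.seq k) : R.step k ∈ C.edges := by
  rw [hE, cycleEdges]
  exact List.mem_map_of_mem (by simp [hk, h])

theorem appearance_of_ne (hC : C.IsCycle) (hE : C.edges = R.cycleEdges) {j : ℕ} (hj : j < n)
    (h : R.a j ≠ R.b j) : appearance C (R.u j) = 2 * Nat.count (Moves R.seq) (2 * j) + 1 := by
  have hm := R.moves_even.mpr h
  have hk : 2 * j < 2 * n := by omega
  rw [← step_even R h, ← cycEdge_count hE hk hm, appearance_cycEdge hC, ZMod.val_natCast,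
    Nat.mod_eq_of_lt]
  rw [length_eq hE]
  exact count_lt hk hm

/-- If an edge of the ring is entered and left at the same vertex, then this is its only vertex on
the cycle. -/
theorem appearance_of_eq (hC : C.IsCycle) (hE : C.edges = R.cycleEdges)
    (hS : C.support =
      R.seq 0 :: ((List.range (2 * n)).filter (Moves R.seq)).map (fun k => R.seq (k + 1)))
    {j : ℕ} (hj : j < n) (h : R.a j = R.b j) :
    appearance C (R.u j) = 2 * Nat.count (Moves R.seq) (2 * j) := by
  have hn := R.four_le
  have hm : ¬ Moves R.seq (2 * j) := by rw [moves_even]; simpa using h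
  have hm' : Moves R.seq (2 * j + 1) := by
    rw [moves_odd]; exact fun ht => a_ne_b_of_touch ht h
  have hc : Nat.count (Moves R.seq) (2 * j + 1) = Nat.count (Moves R.seq) (2 * j) := by
    rw [Nat.count_succ, if_neg hm, add_zero]
  have hlt := count_lt (by omega) hm'
  have key : ∀ k < 2 * n, R.seq k ∈ R.u j → k = 2 * j ∨ k = 2 * j + 1 := by
    intro k hk hmem
    by_cases hkj : ((k / 2 : ℕ) : ZMod n) = j
    · have := natCast_injOn (by omega) hj hkj
      omega
    exfalso
    rcases EdgeRing.touch_of_meets hkj ⟨_, R.seq_mem k, hmem⟩ with ⟨h1, ht⟩ | ⟨h1, ht⟩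
    · have := a_ne_b_succ_of_touch ht
      rw [← h1] at this
      exact this h
    · exact a_ne_b_of_touch ht h
  have hnot : R.u j ∉ C.edges := by
    rw [hE, cycleEdges, List.mem_map]
    rintro ⟨k, hk, he⟩
    simp only [List.mem_filter, List.mem_range, decide_eq_true_eq] at hk
    obtain ⟨i, rfl | rfl⟩ := Nat.even_or_odd' k
    · have hi := R.moves_even.mp hk.2
      rw [step_even _ hi] at he
      have := natCast_injOn (by omega) hj (R.u_injective he)
      subst this
      exact hi h
    · rw [step_odd] at he
      exact u_ne_link (R.moves_odd.mp hk.2) he.symm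
  have := neZero_length hC
  rw [appearance_of_notMem hC hnot (p := (Nat.count (Moves R.seq) (2 * j) : ℕ)), ZMod.val_natCast,
    Nat.mod_eq_of_lt]
  · rw [length_eq hE]; omega
  · rw [cycVert_count hE hS (by omega), seq_even]; exact R.a_mem _
  · intro r hr
    have hrlt : r.val < Nat.count (Moves R.seq) (2 * n) := length_eq hE ▸ r.val_lt
    obtain ⟨k, hk, hmk, hck⟩ := exists_count_eq hrlt
    have hr' : r = (Nat.count (Moves R.seq) k : ℕ) := by rw [hck, ZMod.natCast_zmod_val]
    rw [hr', cycVert_count hE hS hk.le] at hr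
    rw [hr']
    rcases key k hk hr with rfl | rfl
    · rfl
    · rw [hc]

theorem isPartOf_of_prefix (hE : C.edges = R.cycleEdges) {s : ℕ} (hs : s ≤ 2 * n)
    {l : List (Sym2 V)} (h : l <+: ((List.range' s (2 * n)).filter (Moves R.seq)).map R.step) :
    IsPartOf l C := by
  rw [IsPartOf, hE]
  exact exists_prefix_rotate R.moves_add_period R.step_add_period hs h

theorem isPartOf_link_link (hE : C.edges = R.cycleEdges) {k : ℕ} (hk : k < n)
    (h : ¬ R.Touch k) (hab : R.a (k + 1 : ℕ) = R.b (k + 1 : ℕ)) :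
    IsPartOf [R.link k, R.link (k + 1 : ℕ)] C := by
  apply isPartOf_of_prefix hE (s := 2 * k + 1) (by omega)
  obtain ⟨t, ht⟩ : ∃ t, 2 * n = t + 3 := ⟨2 * n - 3, by have := R.four_le; omega⟩
  have e : 2 * k + 1 + 1 = 2 * (k + 1) := by ring
  have h1 := R.moves_odd.mpr h
  have h2 : ¬ Moves R.seq (2 * (k + 1)) := by rw [moves_even]; simpa using hab
  have h3 : Moves R.seq (2 * (k + 1) + 1) := by
    rw [moves_odd]; exact fun ht => a_ne_b_of_touch ht hab
  rw [ht, List.range'_succ, List.range'_succ, List.range'_succ, e,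
    List.filter_cons_of_pos (by simpa using h1), List.filter_cons_of_neg (by simpa using h2),
    List.filter_cons_of_pos (by simpa using h3), List.map_cons, List.map_cons, step_odd, step_odd]
  exact List.prefix_append [_, _] _

theorem isPartOf_link_u_link (hE : C.edges = R.cycleEdges) {k : ℕ} (hk : k < n)
    (h : ¬ R.Touch k) (h' : ¬ R.Touch (k + 1 : ℕ)) (hab : R.a (k + 1 : ℕ) ≠ R.b (k + 1 : ℕ)) :
    IsPartOf [R.link k, R.u (k + 1 : ℕ), R.link (k + 1 : ℕ)] C := by
  apply isPartOf_of_prefix hE (s := 2 * k + 1) (by omega)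
  obtain ⟨t, ht⟩ : ∃ t, 2 * n = t + 3 := ⟨2 * n - 3, by have := R.four_le; omega⟩
  have e : 2 * k + 1 + 1 = 2 * (k + 1) := by ring
  have h1 := R.moves_odd.mpr h
  have h2 := R.moves_even.mpr hab
  have h3 := R.moves_odd.mpr h'
  rw [ht, List.range'_succ, List.range'_succ, List.range'_succ, e,
    List.filter_cons_of_pos (by simpa using h1), List.filter_cons_of_pos (by simpa using h2),
    List.filter_cons_of_pos (by simpa using h3), List.map_cons, List.map_cons, List.map_cons,
    step_odd, step_odd, step_even _ hab]
  exact List.prefix_append [_, _, _] _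

theorem isPartOf_link_u_u_link (hE : C.edges = R.cycleEdges) {k : ℕ} (hk : k < n)
    (h : R.Touch (k + 1 : ℕ)) :
    IsPartOf [R.link k, R.u (k + 1 : ℕ), R.u (k + 2 : ℕ), R.link (k + 2 : ℕ)] C := by
  apply isPartOf_of_prefix hE (s := 2 * k + 1) (by omega)
  obtain ⟨t, ht⟩ : ∃ t, 2 * n = t + 5 := ⟨2 * n - 5, by have := R.four_le; omega⟩
  have e : 2 * k + 1 + 1 = 2 * (k + 1) := by ring
  have e' : 2 * (k + 1) + 1 + 1 = 2 * (k + 2) := by ring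
  have ec : ((k + 2 : ℕ) : ZMod n) = (k + 1 : ℕ) + 1 := by push_cast; ring
  have h1 : Moves R.seq (2 * k + 1) :=
    R.moves_odd.mpr fun h' => h'.not_succ (by simpa using h)
  have hab := a_ne_b_of_touch h
  have hab' : R.a (k + 2 : ℕ) ≠ R.b (k + 2 : ℕ) := by rw [ec]; exact a_ne_b_succ_of_touch h
  have h2 := R.moves_even.mpr hab
  have h3 : ¬ Moves R.seq (2 * (k + 1) + 1) := by rw [moves_odd]; simpa using h
  have h4 := R.moves_even.mpr hab'
  have h5 : Moves R.seq (2 * (k + 2) + 1) := by rw [moves_odd, ec]; exact h.not_succ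
  rw [ht, List.range'_succ, List.range'_succ, List.range'_succ, List.range'_succ,
    List.range'_succ, e, e', List.filter_cons_of_pos (by simpa using h1),
    List.filter_cons_of_pos (by simpa using h2), List.filter_cons_of_neg (by simpa using h3),
    List.filter_cons_of_pos (by simpa using h4), List.filter_cons_of_pos (by simpa using h5),
    List.map_cons, List.map_cons, List.map_cons, List.map_cons,
    step_odd, step_odd, step_even _ hab, step_even _ hab']
  exact List.prefix_append [_, _, _, _] _

end Cycle

end LinkedRing

/-! ### The links of a ring in their order -/

namespace LinkedRing

open scoped Classical

variable {G : SimpleGraph V} {n : ℕ} (R : LinkedRing G n)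

/-- There is a link after the edge number `k` of the ring. -/
abbrev HasLink (k : ℕ) : Prop := ¬ R.Touch k

/-- The number of links. -/
noncomputable def numLinks : ℕ := Nat.count R.HasLink n

/-- The links in their order around the ring: the link number `i` follows the edge number
`R.linkIndex i`. -/
noncomputable def linkIndex (i : Fin R.numLinks) : ℕ := (exists_count_eq i.isLt).choose

theorem linkIndex_lt (i : Fin R.numLinks) : R.linkIndex i < n :=
  (exists_count_eq i.isLt).choose_spec.1

theorem hasLink_linkIndex (i : Fin R.numLinks) : R.HasLink (R.linkIndex i) :=
  (exists_count_eq i.isLt).choose_spec.2.1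

theorem count_linkIndex (i : Fin R.numLinks) : Nat.count R.HasLink (R.linkIndex i) = i :=
  (exists_count_eq i.isLt).choose_spec.2.2

theorem linkIndex_eq {i : Fin R.numLinks} {k : ℕ} (h : R.HasLink k)
    (hc : Nat.count R.HasLink k = i) : R.linkIndex i = k :=
  Nat.count_injective (R.hasLink_linkIndex i) h (by rw [hc, count_linkIndex])

theorem hasLink_last : R.HasLink (n - 1) := by
  have hn := R.four_le
  have := R.not_touch_last
  have e : ((n - 1 : ℕ) : ZMod n) = -1 := by
    rw [Nat.cast_sub (by omega)]
    simp
  rwa [HasLink, e]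

theorem hasLink_succ_of_not {k : ℕ} (h : ¬ R.HasLink k) : R.HasLink (k + 1) := by
  rw [HasLink, Nat.cast_succ]
  exact (not_not.mp h).not_succ

theorem numLinks_eq_count_last : R.numLinks = Nat.count R.HasLink (n - 1) + 1 := by
  have hn := R.four_le
  have e : n = n - 1 + 1 := by omega
  have := Nat.count_succ R.HasLink (n - 1)
  rw [← e, if_pos R.hasLink_last] at this
  exact this

/-- At least every second edge of the ring is followed by a link. -/
theorem le_two_mul_numLinks : n ≤ 2 * R.numLinks := by
  have key : ∀ m, m ≤ 2 * Nat.count R.HasLink m ∨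
      (m ≤ 2 * Nat.count R.HasLink m + 1 ∧ R.HasLink m) := by
    intro m
    induction m with
    | zero => exact Or.inl (by simp)
    | succ m ih =>
      by_cases h : R.HasLink m
      · left
        rw [Nat.count_succ, if_pos h]
        omega
      · right
        rw [Nat.count_succ, if_neg h]
        refine ⟨?_, R.hasLink_succ_of_not h⟩
        rcases ih with ih | ih
        · omega
        · exact absurd ih.2 h
  have := key (n - 1)
  have := R.numLinks_eq_count_last
  omega

theorem linkIndex_of_last {i : Fin R.numLinks} (hi : (i : ℕ) + 1 = R.numLinks) :
    R.linkIndex i = n - 1 :=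
  R.linkIndex_eq R.hasLink_last (by have := R.numLinks_eq_count_last; omega)

theorem linkIndex_of_zero {i : Fin R.numLinks} (hi : (i : ℕ) = 0) :
    (R.HasLink 0 ∧ R.linkIndex i = 0) ∨ (¬ R.HasLink 0 ∧ R.linkIndex i = 1) := by
  by_cases h : R.HasLink 0
  · exact Or.inl ⟨h, R.linkIndex_eq h (by rw [hi, Nat.count_zero])⟩
  · refine Or.inr ⟨h, R.linkIndex_eq (R.hasLink_succ_of_not h) ?_⟩
    rw [hi, Nat.count_succ, if_neg h, Nat.count_zero]

/-- The next link comes after one or, if the two following edges meet, after two more edges. -/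
theorem linkIndex_next {i i' : Fin R.numLinks} (h : Next i i') :
    (R.HasLink (R.linkIndex i + 1) ∧ (R.linkIndex i' : ZMod n) = (R.linkIndex i + 1 : ℕ)) ∨
      (¬ R.HasLink (R.linkIndex i + 1) ∧
        (R.linkIndex i' : ZMod n) = (R.linkIndex i + 2 : ℕ)) := by
  have hn := R.four_le
  rcases next_iff.mp h with h | ⟨h, h'⟩
  · have hc : Nat.count R.HasLink (R.linkIndex i + 1) = i' := by
      rw [Nat.count_succ, if_pos (R.hasLink_linkIndex i), count_linkIndex, h]
    by_cases hk : R.HasLink (R.linkIndex i + 1)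
    · exact Or.inl ⟨hk, by rw [R.linkIndex_eq hk hc]⟩
    · refine Or.inr ⟨hk, ?_⟩
      rw [R.linkIndex_eq (R.hasLink_succ_of_not hk)]
      rw [Nat.count_succ, if_neg hk, hc, add_zero]
  · rw [R.linkIndex_of_last h]
    have e1 : n - 1 + 1 = n := by omega
    have e2 : n - 1 + 2 = n + 1 := by omega
    have e3 : R.HasLink n ↔ R.HasLink 0 := by simp [HasLink]
    rw [e1, e2, e3]
    rcases R.linkIndex_of_zero h' with ⟨h0, hi⟩ | ⟨h0, hi⟩
    · exact Or.inl ⟨h0, by rw [hi]; simp⟩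
    · exact Or.inr ⟨h0, by rw [hi]; simp⟩

theorem ofFn_link_sublist :
    (List.ofFn fun i : Fin R.numLinks => R.link (R.linkIndex i)).Sublist R.cycleEdges := by
  have h1 : (List.ofFn fun i : Fin R.numLinks => R.link (R.linkIndex i)) =
      ((List.range n).filter R.HasLink).map fun k : ℕ => R.link k := by
    apply List.ext_getElem?
    intro r
    by_cases hr : r < R.numLinks
    · rw [List.getElem?_ofFn, dif_pos hr, List.getElem?_map]
      have h2 := filter_range_getElem? (R.hasLink_linkIndex ⟨r, hr⟩) (R.linkIndex_lt ⟨r, hr⟩)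
      rw [count_linkIndex] at h2
      rw [h2]
      rfl
    · rw [List.getElem?_eq_none (by simp; omega), List.getElem?_eq_none]
      rw [List.length_map, ← List.countP_eq_length_filter]
      exact not_lt.mp hr
  have h2 : ∀ m, (((List.range m).filter R.HasLink).map fun k : ℕ => R.link k).Sublist
      (((List.range (2 * m)).filter (Moves R.seq)).map R.step) := by
    intro m
    induction m with
    | zero => simp
    | succ m ih =>
      have e : 2 * (m + 1) = 2 * m + 1 + 1 := by ring
      rw [e, List.range_succ, List.range_succ, List.range_succ, List.append_assoc,
        List.filter_append, List.filter_append, List.map_append, List.map_append]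
      refine ih.append ?_
      have hm := R.moves_odd (i := m)
      by_cases h : R.HasLink m
      · rw [List.filter_append, List.map_append]
        refine List.Sublist.trans ?_ (List.sublist_append_right _ _)
        simp [hm.mpr h, h, step_odd]
      · simp [h]
  rw [h1, cycleEdges]
  exact h2 n

end LinkedRing

/-! ### The sprout of a linked ring -/

namespace LinkedRing

open scoped Classical

variable {G : SimpleGraph V} {n : ℕ} (R : LinkedRing G n)

section Pending

variable {R} {C : G.Walk (R.seq 0) (R.seq 0)}

/-- Two links that follow each other directly on the cycle belong to an edge of the ring that is
entered and left at the same vertex. -/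
theorem eq_of_isPartOf_link_link (hC : C.IsCycle) (hE : C.edges = R.cycleEdges)
    {i i' : Fin R.numLinks} (hi : Next i i')
    (h : IsPartOf [R.link (R.linkIndex i), R.link (R.linkIndex i')] C) :
    R.HasLink (R.linkIndex i + 1) ∧ (R.linkIndex i' : ZMod n) = (R.linkIndex i + 1 : ℕ) ∧
      R.a (R.linkIndex i + 1 : ℕ) = R.b (R.linkIndex i + 1 : ℕ) := by
  have hi' := R.hasLink_linkIndex i'
  rcases R.linkIndex_next hi with ⟨h1, h2⟩ | ⟨h1, -⟩
  · refine ⟨h1, h2, ?_⟩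
    by_contra hab
    exact u_ne_link hi' ((isPartOf_link_u_link hE (R.linkIndex_lt i) (R.hasLink_linkIndex i) h1
      hab).unique_next hC h)
  · exact absurd ((isPartOf_link_u_u_link hE (R.linkIndex_lt i) (not_not.mp h1)).unique_next hC h)
      (u_ne_link hi')

theorem eq_of_mem_link_link {k : ℕ} {j : ZMod n} (h : R.HasLink k) (h' : R.HasLink (k + 1))
    {x : V} (hx : x ∈ R.link k) (hx' : x ∈ R.link (k + 1 : ℕ)) (hj : x ∈ R.u j) :
    j = (k + 1 : ℕ) := by
  rcases eq_of_meets_link h ⟨x, hj, hx⟩ with h1 | h1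
  · rcases eq_of_meets_link h' ⟨x, hj, hx'⟩ with h2 | h2
    · exact h2
    · refine absurd ?_ R.two_ne_zero
      rw [h1] at h2
      push_cast at h2
      linear_combination -h2
  · rw [h1, Nat.cast_succ]

/-- The pending edges are those that are entered and left at the same vertex. -/
theorem pending_iff (hC : C.IsCycle) (hE : C.edges = R.cycleEdges) (j : ZMod n) :
    (∃ i i' : Fin R.numLinks, Next i i' ∧
      IsPartOf [R.link (R.linkIndex i), R.link (R.linkIndex i')] C ∧
      ∃ x, x ∈ R.link (R.linkIndex i) ∧ x ∈ R.link (R.linkIndex i') ∧ x ∈ R.u j) ↔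
    R.a j = R.b j := by
  have hn := R.four_le
  constructor
  · rintro ⟨i, i', hi, hp, x, h1, h2, h3⟩
    obtain ⟨hl, he, hab⟩ := eq_of_isPartOf_link_link hC hE hi hp
    rw [he] at h2
    rwa [← eq_of_mem_link_link (R.hasLink_linkIndex i) hl h1 h2 h3] at hab
  · intro hab
    have : NeZero n := ⟨by omega⟩
    have hk := (j - 1).val_lt
    have hkj : (((j - 1).val + 1 : ℕ) : ZMod n) = j := by
      rw [Nat.cast_succ, ZMod.natCast_zmod_val, sub_add_cancel]
    have hl : R.HasLink (j - 1).val := by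
      intro h
      have := a_ne_b_succ_of_touch h
      rw [← Nat.cast_succ, hkj] at this
      exact this hab
    have hl' : R.HasLink ((j - 1).val + 1) := by
      rw [HasLink, hkj]
      exact fun h => a_ne_b_of_touch h hab
    have hlt : Nat.count R.HasLink (j - 1).val < R.numLinks := by
      exact Nat.count_strict_mono hl hk
    have hi : R.linkIndex ⟨_, hlt⟩ = (j - 1).val := R.linkIndex_eq hl rfl
    obtain ⟨i', hi'⟩ := exists_next (⟨_, hlt⟩ : Fin R.numLinks)
    refine ⟨_, i', hi', ?_⟩
    rcases R.linkIndex_next hi' with ⟨-, he⟩ | ⟨hf, -⟩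
    swap
    · rw [hi] at hf
      exact absurd hl' hf
    rw [he, hi]
    refine ⟨isPartOf_link_link hE hk hl (by rwa [hkj]), R.a j, ?_, ?_, R.a_mem j⟩
    · have := R.a_mem_link ((j - 1).val : ZMod n)
      rwa [← Nat.cast_succ, hkj] at this
    · rw [hkj, hab]
      exact R.b_mem_link j

theorem linkIndex_injective {i i' : Fin R.numLinks}
    (h : (R.linkIndex i : ZMod n) = R.linkIndex i') : i = i' := by
  have := natCast_injOn (R.linkIndex_lt i) (R.linkIndex_lt i') h
  exact Fin.ext (by rw [← R.count_linkIndex i, ← R.count_linkIndex i', this])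

end Pending

/-- The sprout formed by the edges of a linked ring and their links. -/
theorem exists_sprout (R : LinkedRing G n) : ∃ P : Sprout (⊤ : G.Subgraph) n, P.IsFertile := by
  have hn := R.four_le
  have : NeZero n := ⟨by omega⟩
  obtain ⟨C, hC, hE, hS⟩ := R.exists_isCycle
  have cast_inj : ∀ {i j : Fin n}, ((i : ℕ) : ZMod n) = (j : ℕ) → i = j := fun h =>
    Fin.ext (natCast_injOn (Fin.isLt _) (Fin.isLt _) h)
  have next_of : ∀ {i j : Fin n}, ((j : ℕ) : ZMod n) = (i : ℕ) + 1 → Next i j := by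
    intro i j h
    rw [← Nat.cast_succ, ZMod.natCast_eq_natCast_iff', Nat.mod_eq_of_lt j.isLt] at h
    exact h
  have hfar : ∀ i j : Fin n, NonConsecutive i j → ¬ Near G (R.u (i : ℕ)) (R.u (j : ℕ)) := by
    rintro i j ⟨h1, h2, h3⟩ h
    rcases R.eq_of_near _ _ h with h | h | h
    · exact h1 (cast_inj h.symm)
    · exact h2 (next_of h)
    · exact h3 (next_of h)
  refine ⟨{
    q := R.numLinks
    le_q := by have := R.le_two_mul_numLinks; omega
    q_le := Nat.count_le _
    u := fun j => R.u (j : ℕ)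
    w := fun i => R.link (R.linkIndex i)
    u_mem := fun j => by simpa using R.u_mem _
    w_mem := fun i => by simpa using link_mem (R.hasLink_linkIndex i)
    u_injective := fun i j h => cast_inj (R.u_injective h)
    w_injective := fun i j h =>
      linkIndex_injective (link_injective (R.hasLink_linkIndex i) (R.hasLink_linkIndex j) h)
    u_ne_w := fun i j => u_ne_link (R.hasLink_linkIndex j)
    base := R.seq 0
    C := C
    isCycle := hC
    C_mem := fun e he => by simpa using C.edges_subset_edgeSet he
    w_order := by rw [hE]; exact R.ofFn_link_sublist
    u_order := ?_
    u_one := ?_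
    u_two := ?_
    u_disjoint := fun i j hij h => hfar i j hij (h.near (R.u_mem _))
    existsUnique_pending := ?_
    pending_meets := ?_
    joined := ?_
    pending_disjoint := ?_
    mem_of_not_pending := ?_ }, ?_⟩
  · intro i j hij
    have hle : Nat.count (Moves R.seq) (2 * i + 2) ≤ Nat.count (Moves R.seq) (2 * j) :=
      Nat.count_monotone _ (by have := Fin.lt_def.mp hij; omega)
    rw [Nat.count_succ, Nat.count_succ] at hle
    have hj : 2 * Nat.count (Moves R.seq) (2 * j) ≤ appearance C (R.u (j : ℕ)) := by
      by_cases h : R.a (j : ℕ) = R.b (j : ℕ)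
      · exact (appearance_of_eq hC hE hS j.isLt h).ge
      · rw [appearance_of_ne hC hE j.isLt h]; omega
    change appearance C (R.u (i : ℕ)) < appearance C (R.u (j : ℕ))
    by_cases h : R.a (i : ℕ) = R.b (i : ℕ)
    · rw [appearance_of_eq hC hE hS i.isLt h]
      have hm : Moves R.seq (2 * i + 1) := R.moves_odd.mpr fun ht => a_ne_b_of_touch ht h
      rw [if_pos hm] at hle
      omega
    · rw [appearance_of_ne hC hE i.isLt h]
      rw [if_pos (R.moves_even.mpr h)] at hle
      omega
  · intro i j hi hj
    have e : ((n - 1 : ℕ) : ZMod n) + 1 = 0 := by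
      rw [← Nat.cast_succ, Nat.succ_eq_add_one, Nat.sub_add_cancel (by omega), ZMod.natCast_self]
    have := R.link_meets ((n - 1 : ℕ) : ZMod n)
    rw [e] at this
    rw [R.linkIndex_of_last hj, hi, Nat.cast_zero]
    exact this.symm
  · intro i j hi hj
    rw [hi]
    rcases R.linkIndex_of_zero hj with ⟨-, h⟩ | ⟨-, h⟩
    · have := R.link_meets ((0 : ℕ) : ZMod n)
      rw [← Nat.cast_succ] at this
      rw [h]
      exact this.symm
    · rw [h]
      exact R.meets_link _
  · intro i i' hi hp
    obtain ⟨hl, he, hab⟩ := eq_of_isPartOf_link_link hC hE hi hp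
    have hval : (((R.linkIndex i + 1 : ℕ) : ZMod n).val : ZMod n) = (R.linkIndex i + 1 : ℕ) :=
      ZMod.natCast_zmod_val _
    refine ⟨⟨((R.linkIndex i + 1 : ℕ) : ZMod n).val, ZMod.val_lt _⟩, ?_, ?_⟩
    · refine ⟨R.a (R.linkIndex i + 1 : ℕ), ?_, ?_, ?_⟩
      · rw [Nat.cast_succ]; exact R.a_mem_link _
      · rw [he, hab]; exact R.b_mem_link _
      · simp only [hval]; exact R.a_mem _
    · rintro j ⟨x, h1, h2, h3⟩
      rw [he] at h2
      refine cast_inj ?_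
      rw [eq_of_mem_link_link (R.hasLink_linkIndex i) hl h1 h2 h3]
      exact hval.symm
  · rintro i i' hi hp j ⟨x, h1, h2, h3⟩ m hm
    obtain ⟨hl, he, hab⟩ := eq_of_isPartOf_link_link hC hE hi hp
    have h2' := h2
    rw [he] at h2'
    have hj := eq_of_mem_link_link (R.hasLink_linkIndex i) hl h1 h2' h3
    rcases eq_of_meets_link (R.hasLink_linkIndex m) hm with h | h
    · right
      exact linkIndex_injective (by rw [he, ← hj, h])
    · left
      refine linkIndex_injective (add_right_cancel (b := 1) ?_)
      rw [← h, hj, Nat.cast_succ]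
  · intro i i' hi hp
    have hfin : ∀ k : ℕ, ∃ j : Fin n, ((j : ℕ) : ZMod n) = k := fun k =>
      ⟨⟨(k : ZMod n).val, ZMod.val_lt _⟩, ZMod.natCast_zmod_val _⟩
    obtain ⟨j, hj⟩ := hfin (R.linkIndex i + 1)
    obtain ⟨k, hk⟩ := hfin (R.linkIndex i + 2)
    rcases R.linkIndex_next hi with ⟨h1, h2⟩ | ⟨h1, h2⟩
    · refine Or.inl ⟨j, ?_⟩
      rw [h2] at hp
      rw [h2, hj]
      exact isPartOf_link_u_link hE (R.linkIndex_lt i) (R.hasLink_linkIndex i) h1 fun hab =>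
        hp (isPartOf_link_link hE (R.linkIndex_lt i) (R.hasLink_linkIndex i) hab)
    · refine Or.inr ⟨j, k, ?_⟩
      rw [h2, hj, hk]
      exact isPartOf_link_u_u_link hE (R.linkIndex_lt i) (not_not.mp h1)
  · intro j k hjk hj hk h
    rw [pending_iff hC hE] at hj hk
    rcases EdgeRing.touch_of_meets (fun h => hjk (cast_inj h)) h with ⟨-, ht⟩ | ⟨-, ht⟩
    · exact a_ne_b_of_touch ht hj
    · exact a_ne_b_of_touch ht hk
  · intro j hj
    rw [pending_iff hC hE] at hj
    have hm := step_mem_edges hE (k := 2 * j) (by omega) (R.moves_even.mpr hj)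
    rwa [step_even _ hj] at hm
  · rintro e he i j hij ⟨h1, h2⟩
    refine hfar i j hij ⟨e, ?_, h1.symm, h2⟩
    simpa using he.1

end LinkedRing

theorem containsFertileSprout_of_ring {G : SimpleGraph V} {n : ℕ} (hn : 4 ≤ n)
    {u : Fin n → Sym2 V} (hu : ∀ i, u i ∈ G.edgeSet) (hinj : Function.Injective u)
    (hnext : ∀ i j, Next i j → Near G (u i) (u j))
    (hnon : ∀ i j, NonConsecutive i j → ¬ Near G (u i) (u j)) : ContainsFertileSprout G n := by
  have : NeZero n := ⟨by omega⟩
  let f : ZMod n → Fin n := fun z => ⟨z.val, z.val_lt⟩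
  have hf : Function.Injective f := fun x y h => ZMod.val_injective _ (congrArg Fin.val h)
  have hfn : ∀ z, Next (f z) (f (z + 1)) := fun z => by
    rw [next_iff]
    exact zmod_val_add_one (by omega) z
  let D : EdgeRing G n := {
    u := fun z => u (f z)
    four_le := hn
    u_mem := fun z => hu _
    u_injective := hinj.comp hf
    eq_of_near := fun x y h => by
      by_contra hc
      push Not at hc
      refine hnon _ _ ⟨fun h' => hc.1 (hf h').symm, fun h' => ?_, fun h' => ?_⟩ h
      · exact hc.2.1 (hf (h'.unique (hfn x)))
      · exact hc.2.2 (hf (h'.unique (hfn y))) }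
  obtain ⟨R⟩ := D.exists_linkedRing fun z => hnext _ _ (hfn z)
  exact ⟨⊤, fun v _ w _ h => h, R.exists_sprout⟩

end LineGraphSquare

theorem mainTheorem4 {V : Type*} (G : SimpleGraph V) (l : ℕ) (hl : 4 ≤ l) :
    (SimpleGraph.cycleGraph l).IsIndContained (LineGraphSquare.power G.lineGraph 2) ↔
      LineGraphSquare.ContainsFertileSprout G l := by
  rw [LineGraphSquare.cycleGraph_isIndContained_iff G hl]
  constructor
  · rintro ⟨u, hu, hinj, hnext, hnon⟩
    exact LineGraphSquare.containsFertileSprout_of_ring hl hu hinj hnext hnon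
  · rintro ⟨S, hS, P, hP⟩
    exact ⟨P.u, P.u_mem_edgeSet, P.u_injective, fun i j h => P.near_of_next hl h,
      fun i j h => P.not_near_of_nonConsecutive hl hS hP h⟩
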